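/- Smooth manifolds are finite-dimensional, without boundary, Hausdorff and second countable (for the Lie groupoid below, neither the Hausdorff property nor countability is needed, and the dimension may vary between components). Let $M$ be a smooth manifold. A path $\gamma:x\to y$ in $M$ is a smooth map $\gamma:[0,1]\to M$ with sitting instants: for some $0<\epsilon<\frac12$, $\gamma(t)=x$ for $t<\epsilon$ and $\gamma(t)=y$ for $t>1-\epsilon$. Two paths $\gamma_1,\gamma_2:x\to y$ are thin homotopy equivalent if there is a smooth map $h:[0,1]^2\to M$ with $\mathrm{rank}(\mathrm dh)\le 1$ everywhere and, for some $0<\epsilon<\frac12$, $h(s,t)=x$ for $t<\epsilon$, $h(s,t)=y$ for $t>1-\epsilon$, $h(s,t)=\gamma_1(t)$ for $s<\epsilon$ and $h(s,t)=\gamma_2(t)$ for $s>1-\epsilon$. The path groupoid $\mathcal P_1(M)$ has the points of $M$ as objects and the thin homotopy classes $\overline\gamma:x\to y$ of paths as morphisms, composed by concatenation. A smooth map $f:M\to N$ induces a functor $f_*:\mathcal P_1(M)\to\mathcal P_1(N)$. A smooth family of paths is a map $c$ from an open set $U\subset\mathbb R^k$, $k\ge 0$, to the set of paths, such that $(u,t)\mapsto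 c(u)(t)$ is smooth on $U\times[0,1]$. A Lie groupoid $\mathrm{Gr}$ is a groupoid whose sets of objects and of morphisms are smooth manifolds, such that source and target are surjective submersions and composition and identities are smooth. A functor $G:\mathcal P_1(X)\to\mathrm{Gr}$ is smooth if it is smooth on objects and $u\mapsto G(\overline{c(u)})\in\mathrm{Mor}(\mathrm{Gr})$ is smooth for every smooth family $c$ of paths in $X$. Let $T$ be a category, $i:\mathrm{Gr}\to T$ a functor and $F:\mathcal P_1(M)\to T$ a functor. $F$ is a transport functor with $\mathrm{Gr}$-structure if there are a surjective submersion $\pi:Y\to M$ of smooth manifolds, a functor $\mathrm{triv}:\mathcal P_1(Y)\to\mathrm{Gr}$ and a natural equivalence $t:F\circ\pi_*\to i\circ\mathrm{triv}$ such that $\mathrm{triv}$ is smooth and the natural equivalence $g$ over $Y^{[2]}=Y\times_MY$ with components $g(y,y')=t(y')\circ t(y)^{-1}$ is of the form $g(\alpha)=i(\tilde g(\alpha))$, for a natural equivalence $\tilde g:\pi_1^*\mathrm{triv}\to\pi_2^*\mathrm{triv}$ of functors on $\mathcal P_1(Y^{[2]})$ whose components form a smooth map $\tilde g:Y^{[2]}\to\mathrm{Mor}(\mathrm{Gr})$.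 Suppose now that $i$ is an equivalence of categories. For points $x_1,x_2\in M$, objects $G_1,G_2$ of $\mathrm{Gr}$ and isomorphisms $t_k:F(x_k)\to i(G_k)$ in $T$, the Wilson line of $F$ from $x_1$ to $x_2$ is the map $$\mathcal W^{F,i}_{x_1,x_2}:\mathrm{Mor}_{\mathcal P_1(M)}(x_1,x_2)\to\mathrm{Mor}_{\mathrm{Gr}}(G_1,G_2),\qquad \overline\gamma\mapsto i^{-1}\big(t_2\circ F(\overline\gamma)\circ t_1^{-1}\big).$$ It is smooth if for every smooth family $c$, over an open set $U\subset\mathbb R^k$, $k\ge0$, of paths from $x_1$ to $x_2$, the map $U\to\mathrm{Mor}(\mathrm{Gr})$, $u\mapsto\mathcal W^{F,i}_{x_1,x_2}(\overline{c(u)})$, is smooth. **Theorem.** Let $i:\mathrm{Gr}\to T$ be an equivalence of categories and let $F:\mathcal P_1(M)\to T$ be a functor. For every pair $(x_1,x_2)$ of points in $M$ choose $G_1,G_2,t_1,t_2$ as above, arbitrarily. Then $F$ is a transport functor with $\mathrm{Gr}$-structure if and only if, for every pair $(x_1,x_2)$ of points in $M$, the Wilson line $\mathcal W^{F,i}_{x_1,x_2}$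 for this choice is smooth. -/

import Mathlib

open CategoryTheory Set Topology
open scoped Manifold ContDiff

namespace ParallelTransport

/-! ### Smooth paths with sitting instants and thin homotopies -/

section Paths

variable {E : Type*} [NormedAddCommGroup E] [NormedSpace ℝ E]
  {H : Type*} [TopologicalSpace H] {I : ModelWithCorners ℝ E H}
  {M : Type*} [TopologicalSpace M] [ChartedSpace H M]
  {E' : Type*} [NormedAddCommGroup E'] [NormedSpace ℝ E']
  {H' : Type*} [TopologicalSpace H'] {I' : ModelWithCorners ℝ E' H'}
  {N : Type*} [TopologicalSpace N] [ChartedSpace H' N]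

/-- A path `γ : x ⟶ y` in a manifold: a smooth map `[0,1] → M` that is constantly `x` near `0`
and constantly `y` near `1`. -/
structure SmoothPath (I : ModelWithCorners ℝ E H) (x y : M) extends Path x y where
  smooth : ContMDiff (𝓡∂ 1) I ∞ (fun t : unitInterval => toPath t)
  sitting : ∃ ε : ℝ, 0 < ε ∧ ε < 1 / 2 ∧
    (∀ t : unitInterval, (t : ℝ) < ε → toPath t = x) ∧
    (∀ t : unitInterval, 1 - ε < (t : ℝ) → toPath t = y)

/-- Thin homotopy equivalence of two paths `x ⟶ y`. -/
def ThinHomotopic {x y : M} (γ₁ γ₂ : SmoothPath I x y) : Prop :=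
  ∃ h : unitInterval × unitInterval → M,
    ContMDiff ((𝓡∂ 1).prod (𝓡∂ 1)) I ∞ h ∧
    (∃ ε : ℝ, 0 < ε ∧ ε < 1 / 2 ∧
      (∀ s t : unitInterval, (t : ℝ) < ε → h (s, t) = x) ∧
      (∀ s t : unitInterval, 1 - ε < (t : ℝ) → h (s, t) = y) ∧
      (∀ s t : unitInterval, (s : ℝ) < ε → h (s, t) = γ₁.toPath t) ∧
      (∀ s t : unitInterval, 1 - ε < (s : ℝ) → h (s, t) = γ₂.toPath t)) ∧
    ∀ p, LinearMap.rank (mfderiv ((𝓡∂ 1).prod (𝓡∂ 1)) I h p).toLinearMap ≤ 1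

/-- Auxiliary: `h` is smooth with differential of rank at most one at `p`. -/
def ThinAt (I : ModelWithCorners ℝ E H) (h : ℝ × ℝ → M) (p : ℝ × ℝ) : Prop :=
  ContMDiffAt 𝓘(ℝ, ℝ × ℝ) I ∞ h p ∧
    LinearMap.rank (mfderiv 𝓘(ℝ, ℝ × ℝ) I h p).toLinearMap ≤ 1

theorem ThinAt.congr {h h' : ℝ × ℝ → M} {p : ℝ × ℝ} (H1 : ThinAt I h p) (e : h' =ᶠ[𝓝 p] h) :
    ThinAt I h' p := by
  refine ⟨H1.1.congr_of_eventuallyEq e, ?_⟩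
  have := e.mfderiv_eq (I := 𝓘(ℝ, ℝ × ℝ)) (I' := I)
  have hp := e.self_of_nhds
  have key : ∀ (a b : M) (hab : a = b) (L : TangentSpace 𝓘(ℝ, ℝ × ℝ) p →L[ℝ] TangentSpace I a)
      (L' : TangentSpace 𝓘(ℝ, ℝ × ℝ) p →L[ℝ] TangentSpace I b),
      HEq L L' → LinearMap.rank L'.toLinearMap ≤ 1 → LinearMap.rank L.toLinearMap ≤ 1 := by
    rintro a _ rfl L L' h1 h2
    cases h1
    exact h2
  exact key _ _ hp _ _ (heq_of_eq this) H1.2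

theorem ThinAt.comp {h : ℝ × ℝ → M} {A : ℝ × ℝ → ℝ × ℝ} {p : ℝ × ℝ} (H1 : ThinAt I h (A p))
    (hA : ContDiff ℝ ∞ A) : ThinAt I (fun q => h (A q)) p := by
  have hA' : ContMDiffAt 𝓘(ℝ, ℝ × ℝ) 𝓘(ℝ, ℝ × ℝ) ∞ A p := hA.contMDiff.contMDiffAt
  refine ⟨H1.1.comp p hA', ?_⟩
  have := mfderiv_comp (I := 𝓘(ℝ, ℝ × ℝ)) (I' := 𝓘(ℝ, ℝ × ℝ)) (I'' := I) p
    (H1.1.mdifferentiableAt (by simp)) (hA'.mdifferentiableAt (by simp))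
  change LinearMap.rank (mfderiv 𝓘(ℝ, ℝ × ℝ) I (h ∘ A) p).toLinearMap ≤ 1
  rw [this]
  exact (LinearMap.rank_comp_le_left _ _).trans H1.2

theorem thinAt_line {G : ℝ → M} {f : ℝ × ℝ → ℝ} (p : ℝ × ℝ)
    (hG : ContMDiff 𝓘(ℝ, ℝ) I ∞ G) (hf : ContDiff ℝ ∞ f) : ThinAt I (fun q => G (f q)) p := by
  have hf' : ContMDiffAt 𝓘(ℝ, ℝ × ℝ) 𝓘(ℝ, ℝ) ∞ f p := hf.contMDiff.contMDiffAt
  refine ⟨(hG.contMDiffAt).comp p hf', ?_⟩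
  have := mfderiv_comp (I := 𝓘(ℝ, ℝ × ℝ)) (I' := 𝓘(ℝ, ℝ)) (I'' := I) p
    (hG.contMDiffAt.mdifferentiableAt (by simp)) (hf'.mdifferentiableAt (by simp))
  change LinearMap.rank (mfderiv 𝓘(ℝ, ℝ × ℝ) I (G ∘ f) p).toLinearMap ≤ 1
  rw [this]
  refine (LinearMap.rank_comp_le_left _ _).trans ?_
  have h1 : Cardinal.lift (LinearMap.rank (mfderiv 𝓘(ℝ, ℝ) I G (f p)).toLinearMap) ≤
      Cardinal.lift (Module.rank ℝ ℝ) :=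
    lift_rank_range_le (mfderiv 𝓘(ℝ, ℝ) I G (f p)).toLinearMap
  rw [Module.rank_self, Cardinal.lift_one] at h1
  exact Cardinal.lift_le_one_iff.mp h1

theorem thinAt_const (c : M) (p : ℝ × ℝ) : ThinAt I (fun _ => c) p :=
  thinAt_line (G := fun _ => c) (f := fun _ => 0) p contMDiff_const contDiff_const

namespace SmoothPath

variable {x y z : M}

/-- The extension of a path to the real line, constant outside of `[0,1]`. -/
noncomputable def ext (γ : SmoothPath I x y) : ℝ → M := γ.toPath.extend

theorem ext_coe (γ : SmoothPath I x y) (t : unitInterval) : γ.ext t = γ.toPath t :=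
  γ.toPath.extend_extends' t

theorem ext_eq (γ : SmoothPath I x y) (t : ℝ) :
    γ.ext t = γ.toPath (projIcc 0 1 zero_le_one t) := rfl

theorem ext_sitting (γ : SmoothPath I x y) : ∃ ε : ℝ, 0 < ε ∧ ε < 1 / 2 ∧
    (∀ t : ℝ, t < ε → γ.ext t = x) ∧ (∀ t : ℝ, 1 - ε < t → γ.ext t = y) := by
  obtain ⟨ε, h0, h1, h2, h3⟩ := γ.sitting
  refine ⟨ε, h0, h1, fun t ht => ?_, fun t ht => ?_⟩
  · rw [ext_eq]
    apply h2
    rw [coe_projIcc]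
    exact max_lt h0 ((min_le_right _ _).trans_lt ht)
  · rw [ext_eq]
    apply h3
    rw [coe_projIcc]
    exact lt_max_of_lt_right (lt_min (by linarith) ht)

theorem contMDiffAt_projIcc {t : ℝ} (h0 : 0 < t) (h1 : t < 1) :
    ContMDiffAt 𝓘(ℝ, ℝ) (𝓡∂ 1) ∞ (projIcc (0 : ℝ) 1 zero_le_one) t :=
  (contMDiffOn_projIcc (x := (0 : ℝ)) (y := 1) t ⟨h0.le, h1.le⟩).contMDiffAt
    (Icc_mem_nhds h0 h1)

theorem ext_smooth (γ : SmoothPath I x y) : ContMDiff 𝓘(ℝ, ℝ) I ∞ γ.ext := by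
  obtain ⟨ε, h0, h1, h2, h3⟩ := γ.ext_sitting
  intro t
  rcases lt_or_ge t ε with h | h
  · refine (contMDiffAt_const (c := x)).congr_of_eventuallyEq ?_
    filter_upwards [Iio_mem_nhds h] with s hs using h2 s hs
  rcases lt_or_ge (1 - ε) t with h' | h'
  · refine (contMDiffAt_const (c := y)).congr_of_eventuallyEq ?_
    filter_upwards [Ioi_mem_nhds h'] with s hs using h3 s hs
  · exact (γ.smooth _).comp t (contMDiffAt_projIcc (by linarith) (by linarith))

/-- A smooth map on the real line that is constant near `(-∞,0]` and near `[1,∞)` restricts to a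
path. -/
noncomputable def ofLine (f : ℝ → M) (hf : ContMDiff 𝓘(ℝ, ℝ) I ∞ f)
    (hs : ∃ ε : ℝ, 0 < ε ∧ (∀ t : ℝ, t < ε → f t = x) ∧ (∀ t : ℝ, 1 - ε < t → f t = y)) :
    SmoothPath I x y where
  toPath := Path.ofLine (f := f) hf.continuous.continuousOn
    (by obtain ⟨ε, h0, h1, h2⟩ := hs; exact h1 _ h0)
    (by obtain ⟨ε, h0, h1, h2⟩ := hs; exact h2 _ (by linarith))
  smooth := hf.comp contMDiff_subtypeVal_Icc
  sitting := by
    obtain ⟨ε, h0, h1, h2⟩ := hs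
    refine ⟨min ε (1 / 4), by positivity, ?_, fun t ht => ?_, fun t ht => ?_⟩
    · exact (min_le_right _ _).trans_lt (by norm_num)
    · exact h1 _ (ht.trans_le (min_le_left _ _))
    · exact h2 _ (by have := min_le_left ε (1 / 4); linarith)

theorem ofLine_ext {f : ℝ → M} (hf : ContMDiff 𝓘(ℝ, ℝ) I ∞ f)
    (hs : ∃ ε : ℝ, 0 < ε ∧ (∀ t : ℝ, t < ε → f t = x) ∧ (∀ t : ℝ, 1 - ε < t → f t = y)) :
    (ofLine f hf hs).ext = f := by
  obtain ⟨ε, h0, h1, h2⟩ := id hs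
  funext t
  have e : (ofLine f hf hs).ext t = f (projIcc (0 : ℝ) 1 zero_le_one t) := rfl
  rw [e]
  rcases le_or_gt t 0 with h | h
  · rw [projIcc_of_le_left _ h, h1 t (by linarith)]
    exact h1 _ h0
  rcases le_or_gt 1 t with h' | h'
  · rw [projIcc_of_right_le _ h', h2 t (by linarith)]
    exact h2 _ (by linarith)
  · rw [projIcc_of_mem _ ⟨h.le, h'.le⟩]

theorem ext_injective {γ γ' : SmoothPath I x y} (h : γ.ext = γ'.ext) : γ = γ' := by
  have : γ.toPath = γ'.toPath := by
    apply Path.ext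
    funext t
    rw [← ext_coe, ← ext_coe, h]
  cases γ; cases γ'; cases this; rfl

end SmoothPath

/-- Thin homotopies extend to the plane. -/
theorem thinHomotopic_iff {x y : M} (γ₁ γ₂ : SmoothPath I x y) :
    ThinHomotopic γ₁ γ₂ ↔ ∃ h : ℝ × ℝ → M, (∀ p, ThinAt I h p) ∧
      ∃ ε : ℝ, 0 < ε ∧
        (∀ s t : ℝ, t < ε → h (s, t) = x) ∧
        (∀ s t : ℝ, 1 - ε < t → h (s, t) = y) ∧
        (∀ s t : ℝ, s < ε → h (s, t) = γ₁.ext t) ∧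
        (∀ s t : ℝ, 1 - ε < s → h (s, t) = γ₂.ext t) := by
  constructor
  · rintro ⟨h, hsm, ⟨ε, e0, e1, ha, hb, hc, hd⟩, hr⟩
    have lo : ∀ t : ℝ, t < ε → ((projIcc (0 : ℝ) 1 zero_le_one t : unitInterval) : ℝ) < ε := by
      intro t ht
      rw [coe_projIcc]
      exact max_lt e0 ((min_le_right _ _).trans_lt ht)
    have hi : ∀ t : ℝ, 1 - ε < t →
        1 - ε < ((projIcc (0 : ℝ) 1 zero_le_one t : unitInterval) : ℝ) := by
      intro t ht
      rw [coe_projIcc]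
      exact lt_max_of_lt_right (lt_min (by linarith) ht)
    set k : ℝ × ℝ → M := fun p =>
      h (projIcc (0 : ℝ) 1 zero_le_one p.1, projIcc (0 : ℝ) 1 zero_le_one p.2) with hk
    have ka : ∀ s t : ℝ, t < ε → k (s, t) = x := fun s t ht => ha _ _ (lo t ht)
    have kb : ∀ s t : ℝ, 1 - ε < t → k (s, t) = y := fun s t ht => hb _ _ (hi t ht)
    have kc : ∀ s t : ℝ, s < ε → k (s, t) = γ₁.ext t := fun s t ht => hc _ _ (lo s ht)
    have kd : ∀ s t : ℝ, 1 - ε < s → k (s, t) = γ₂.ext t := fun s t ht => hd _ _ (hi s ht)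
    refine ⟨k, ?_, ε, e0, ka, kb, kc, kd⟩
    rintro ⟨s, t⟩
    have c1 : ContinuousAt (fun p : ℝ × ℝ => p.1) (s, t) := continuousAt_fst
    have c2 : ContinuousAt (fun p : ℝ × ℝ => p.2) (s, t) := continuousAt_snd
    rcases lt_or_ge t ε with h1 | h1
    · refine (thinAt_const x (s, t)).congr ?_
      filter_upwards [c2.eventually (Iio_mem_nhds h1)] with p hp using ka _ _ hp
    rcases lt_or_ge (1 - ε) t with h2 | h2
    · refine (thinAt_const y (s, t)).congr ?_
      filter_upwards [c2.eventually (Ioi_mem_nhds h2)] with p hp using kb _ _ hp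
    rcases lt_or_ge s ε with h3 | h3
    · refine (thinAt_line (f := Prod.snd) (s, t) γ₁.ext_smooth contDiff_snd).congr ?_
      filter_upwards [c1.eventually (Iio_mem_nhds h3)] with p hp using kc _ _ hp
    rcases lt_or_ge (1 - ε) s with h4 | h4
    · refine (thinAt_line (f := Prod.snd) (s, t) γ₂.ext_smooth contDiff_snd).congr ?_
      filter_upwards [c1.eventually (Ioi_mem_nhds h4)] with p hp using kd _ _ hp
    have hA : ContMDiffAt 𝓘(ℝ, ℝ × ℝ) ((𝓡∂ 1).prod (𝓡∂ 1)) ∞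
        (fun p : ℝ × ℝ => ((projIcc (0 : ℝ) 1 zero_le_one p.1, projIcc (0 : ℝ) 1 zero_le_one p.2) :
          unitInterval × unitInterval)) (s, t) := by
      refine ContMDiffAt.prodMk ?_ ?_
      · exact (SmoothPath.contMDiffAt_projIcc (by linarith) (by linarith)).comp
          (f := (Prod.fst : ℝ × ℝ → ℝ)) (s, t) contDiff_fst.contMDiff.contMDiffAt
      · exact (SmoothPath.contMDiffAt_projIcc (by linarith) (by linarith)).comp
          (f := (Prod.snd : ℝ × ℝ → ℝ)) (s, t) contDiff_snd.contMDiff.contMDiffAt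
    refine ⟨(hsm _).comp (s, t) hA, ?_⟩
    have := mfderiv_comp (I := 𝓘(ℝ, ℝ × ℝ)) (I' := (𝓡∂ 1).prod (𝓡∂ 1)) (I'' := I) (s, t)
      ((hsm _).mdifferentiableAt (by simp)) (hA.mdifferentiableAt (by simp))
    refine Eq.trans_le (congrArg (fun L => LinearMap.rank (ContinuousLinearMap.toLinearMap L))
      this) ?_
    exact (LinearMap.rank_comp_le_left _ _).trans (hr _)
  · rintro ⟨k, hk, ε, e0, ka, kb, kc, kd⟩
    have hA : ContMDiff ((𝓡∂ 1).prod (𝓡∂ 1)) 𝓘(ℝ, ℝ × ℝ) ∞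
        (fun p : unitInterval × unitInterval => ((p.1 : ℝ), (p.2 : ℝ))) := by
      refine ContMDiff.prodMk_space ?_ ?_
      · exact contMDiff_subtypeVal_Icc.comp contMDiff_fst
      · exact contMDiff_subtypeVal_Icc.comp contMDiff_snd
    refine ⟨fun p => k (p.1, p.2), fun p => (hk _).1.comp p hA.contMDiffAt,
      ⟨min ε (1 / 4), by positivity, ?_, ?_, ?_, ?_, ?_⟩, ?_⟩
    · exact (min_le_right _ _).trans_lt (by norm_num)
    · exact fun s t ht => ka _ _ (ht.trans_le (min_le_left _ _))
    · exact fun s t ht => kb _ _ (by have := min_le_left ε (1 / 4); linarith)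
    · intro s t ht
      rw [← SmoothPath.ext_coe]
      exact kc _ _ (ht.trans_le (min_le_left _ _))
    · intro s t ht
      rw [← SmoothPath.ext_coe]
      exact kd _ _ (by have := min_le_left ε (1 / 4); linarith)
    · intro p
      have := mfderiv_comp (I := (𝓡∂ 1).prod (𝓡∂ 1)) (I' := 𝓘(ℝ, ℝ × ℝ)) (I'' := I) p
        ((hk _).1.mdifferentiableAt (by simp)) (hA.contMDiffAt.mdifferentiableAt (by simp))
      refine Eq.trans_le (congrArg (fun L => LinearMap.rank (ContinuousLinearMap.toLinearMap L))
        this) ?_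
      exact (LinearMap.rank_comp_le_left _ _).trans (hk _).2

theorem ThinHomotopic.refl {x y : M} (γ : SmoothPath I x y) : ThinHomotopic γ γ := by
  obtain ⟨ε, h0, h1, h2, h3⟩ := γ.ext_sitting
  exact (thinHomotopic_iff _ _).2 ⟨fun p => γ.ext p.2,
    fun p => thinAt_line p γ.ext_smooth contDiff_snd, ε, h0, fun _ t ht => h2 t ht,
    fun _ t ht => h3 t ht, fun _ _ _ => rfl, fun _ _ _ => rfl⟩

theorem ThinHomotopic.symm {x y : M} {γ γ' : SmoothPath I x y} (h : ThinHomotopic γ γ') :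
    ThinHomotopic γ' γ := by
  obtain ⟨k, hk, ε, e0, ka, kb, kc, kd⟩ := (thinHomotopic_iff _ _).1 h
  refine (thinHomotopic_iff _ _).2 ⟨fun p => k (1 - p.1, p.2), fun p => ?_, ε, e0, ?_, ?_, ?_, ?_⟩
  · exact (hk _).comp (A := fun p => (1 - p.1, p.2)) (by fun_prop)
  · exact fun s t ht => ka _ _ ht
  · exact fun s t ht => kb _ _ ht
  · exact fun s t ht => kd _ _ (by linarith)
  · exact fun s t ht => kc _ _ (by linarith)

theorem ThinHomotopic.trans {x y : M} {γ₁ γ₂ γ₃ : SmoothPath I x y} (h : ThinHomotopic γ₁ γ₂)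
    (h' : ThinHomotopic γ₂ γ₃) : ThinHomotopic γ₁ γ₃ := by
  obtain ⟨k, hk, ε, e0, ka, kb, kc, kd⟩ := (thinHomotopic_iff _ _).1 h
  obtain ⟨l, hl, δ, d0, la, lb, lc, ld⟩ := (thinHomotopic_iff _ _).1 h'
  have hm : 0 < min (min ε δ) 1 := by positivity
  have m1 : min (min ε δ) 1 ≤ ε := (min_le_left _ _).trans (min_le_left _ _)
  have m2 : min (min ε δ) 1 ≤ δ := (min_le_left _ _).trans (min_le_right _ _)
  have m3 : min (min ε δ) 1 ≤ 1 := min_le_right _ _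
  generalize min (min ε δ) 1 = η at hm m1 m2 m3
  refine (thinHomotopic_iff _ _).2
    ⟨fun p => if p.1 ≤ 1 / 2 then k (2 * p.1, p.2) else l (2 * p.1 - 1, p.2), ?_,
      η / 2, by positivity, ?_, ?_, ?_, ?_⟩
  · rintro ⟨s, t⟩
    have c1 : ContinuousAt (fun p : ℝ × ℝ => p.1) (s, t) := continuousAt_fst
    rcases lt_trichotomy s (1 / 2) with hs | hs | hs
    · refine ((hk _).comp (A := fun p => (2 * p.1, p.2)) (by fun_prop)).congr ?_
      filter_upwards [c1.eventually (Iio_mem_nhds hs)] with p hp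
      rw [if_pos (le_of_lt hp)]
    · refine (thinAt_line (f := Prod.snd) (s, t) γ₂.ext_smooth contDiff_snd).congr ?_
      filter_upwards [c1.eventually (Ioo_mem_nhds (a := 1 / 2 - η / 2) (b := 1 / 2 + η / 2)
        (by linarith) (by linarith))] with p hp
      have h1 := hp.1
      have h2 := hp.2
      split_ifs
      · exact kd _ _ (by linarith)
      · exact lc _ _ (by linarith)
    · refine ((hl _).comp (A := fun p => (2 * p.1 - 1, p.2)) (by fun_prop)).congr ?_
      filter_upwards [c1.eventually (Ioi_mem_nhds hs)] with p hp
      rw [if_neg (not_le_of_gt hp)]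
  · intro s t ht
    dsimp only
    split_ifs
    · exact ka _ _ (by linarith)
    · exact la _ _ (by linarith)
  · intro s t ht
    dsimp only
    split_ifs
    · exact kb _ _ (by linarith)
    · exact lb _ _ (by linarith)
  · intro s t ht
    dsimp only
    rw [if_pos (by linarith)]
    exact kc _ _ (by linarith)
  · intro s t ht
    dsimp only
    rw [if_neg (by linarith)]
    exact ld _ _ (by linarith)

/-- Two reparametrizations of the same smooth curve are thinly homotopic if the straight homotopy
between the reparametrizations fixes the curve near the end points. -/
theorem thinHomotopic_of_line {x y : M} {γ₀ γ₁ : SmoothPath I x y} {G : ℝ → M} {φ₀ φ₁ : ℝ → ℝ}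
    (hG : ContMDiff 𝓘(ℝ, ℝ) I ∞ G) (h₀ : ContDiff ℝ ∞ φ₀) (h₁ : ContDiff ℝ ∞ φ₁)
    (e₀ : γ₀.ext = fun t => G (φ₀ t)) (e₁ : γ₁.ext = fun t => G (φ₁ t))
    (hs : ∃ ε : ℝ, 0 < ε ∧ (∀ t : ℝ, t < ε → ∀ a : ℝ, 0 ≤ a → a ≤ 1 →
        G ((1 - a) * φ₀ t + a * φ₁ t) = x) ∧
      (∀ t : ℝ, 1 - ε < t → ∀ a : ℝ, 0 ≤ a → a ≤ 1 → G ((1 - a) * φ₀ t + a * φ₁ t) = y)) :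
    ThinHomotopic γ₀ γ₁ := by
  obtain ⟨ε, e0, ha, hb⟩ := hs
  have hT : ContDiff ℝ ∞ Real.smoothTransition := Real.smoothTransition.contDiff
  refine (thinHomotopic_iff _ _).2 ⟨fun p =>
    G ((1 - Real.smoothTransition (3 * p.1 - 1)) * φ₀ p.2 +
      Real.smoothTransition (3 * p.1 - 1) * φ₁ p.2), fun p => ?_,
      min ε (1 / 3), by positivity, ?_, ?_, ?_, ?_⟩
  · refine thinAt_line (f := fun p => (1 - Real.smoothTransition (3 * p.1 - 1)) * φ₀ p.2 +
      Real.smoothTransition (3 * p.1 - 1) * φ₁ p.2) p hG ?_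
    have : ContDiff ℝ ∞ (fun p : ℝ × ℝ => Real.smoothTransition (3 * p.1 - 1)) :=
      hT.comp (by fun_prop)
    fun_prop
  · exact fun s t ht => ha _ (ht.trans_le (min_le_left _ _)) _
      (Real.smoothTransition.nonneg _) (Real.smoothTransition.le_one _)
  · exact fun s t ht => hb _ (by have := min_le_left ε (1 / 3); linarith) _
      (Real.smoothTransition.nonneg _) (Real.smoothTransition.le_one _)
  · intro s t hs
    have := min_le_right ε (1 / 3)
    dsimp only
    rw [Real.smoothTransition.zero_of_nonpos (by linarith), e₀]
    simp
  · intro s t hs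
    have := min_le_right ε (1 / 3)
    dsimp only
    rw [Real.smoothTransition.one_of_one_le (by linarith), e₁]
    simp

namespace SmoothPath

variable {x y z w : M}

/-- The constant path. -/
noncomputable def refl (x : M) : SmoothPath I x x where
  toPath := Path.refl x
  smooth := contMDiff_const
  sitting := ⟨1 / 4, by norm_num, by norm_num, fun _ _ => rfl, fun _ _ => rfl⟩

theorem refl_ext (x : M) : (refl x : SmoothPath I x x).ext = fun _ => x := rfl

/-- The composition `γ' ∘ γ` of two paths: first `γ` on `[0,1/2]`, then `γ'` on `[1/2,1]`. -/
noncomputable def trans (γ : SmoothPath I x y) (γ' : SmoothPath I y z) : SmoothPath I x z where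
  toPath := γ.toPath.trans γ'.toPath
  smooth := by
    obtain ⟨ε, e0, e1, h1, h2⟩ := γ.ext_sitting
    obtain ⟨δ, d0, d1, h3, h4⟩ := γ'.ext_sitting
    have key : ContMDiff 𝓘(ℝ, ℝ) I ∞ (γ.toPath.trans γ'.toPath).extend := by
      intro t
      rcases lt_trichotomy t (1 / 2) with ht | ht | ht
      · refine (γ.ext_smooth.comp (g := γ.ext) (f := fun t : ℝ => 2 * t)
          (ContDiff.contMDiff (by fun_prop)) t).congr_of_eventuallyEq ?_
        filter_upwards [Iio_mem_nhds ht] with s hs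
        exact Path.extend_trans_of_le_half _ _ (le_of_lt hs)
      · refine (contMDiffAt_const (c := y)).congr_of_eventuallyEq ?_
        filter_upwards [Ioo_mem_nhds (a := 1 / 2 - ε / 2) (b := 1 / 2 + δ / 2)
          (by linarith) (by linarith)] with s hs
        rcases le_or_gt s (1 / 2) with h | h
        · rw [Path.extend_trans_of_le_half _ _ h]
          exact h2 _ (by linarith [hs.1])
        · rw [Path.extend_trans_of_half_le _ _ h.le]
          exact h3 _ (by linarith [hs.2])
      · refine (γ'.ext_smooth.comp (g := γ'.ext) (f := fun t : ℝ => 2 * t - 1)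
          (ContDiff.contMDiff (by fun_prop)) t).congr_of_eventuallyEq ?_
        filter_upwards [Ioi_mem_nhds ht] with s hs
        exact Path.extend_trans_of_half_le _ _ (le_of_lt hs)
    have := key.comp (contMDiff_subtypeVal_Icc (x := (0 : ℝ)) (y := 1))
    refine this.congr fun t => ?_
    exact ((γ.toPath.trans γ'.toPath).extend_extends' t).symm
  sitting := by
    obtain ⟨ε, e0, e1, h1, h2⟩ := γ.ext_sitting
    obtain ⟨δ, d0, d1, h3, h4⟩ := γ'.ext_sitting
    have hm : 0 < min (ε / 2) (δ / 2) := by positivity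
    have m1 := min_le_left (ε / 2) (δ / 2)
    have m2 := min_le_right (ε / 2) (δ / 2)
    refine ⟨min (ε / 2) (δ / 2), hm, by linarith, fun t ht => ?_, fun t ht => ?_⟩
    · rw [← Path.extend_extends', Path.extend_trans_of_le_half _ _ (by linarith)]
      exact h1 _ (by linarith)
    · rw [← Path.extend_extends', Path.extend_trans_of_half_le _ _ (by linarith)]
      exact h4 _ (by linarith)

theorem trans_ext_of_le (γ : SmoothPath I x y) (γ' : SmoothPath I y z) {t : ℝ} (ht : t ≤ 1 / 2) :
    (γ.trans γ').ext t = γ.ext (2 * t) :=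
  Path.extend_trans_of_le_half _ _ ht

theorem trans_ext_of_ge (γ : SmoothPath I x y) (γ' : SmoothPath I y z) {t : ℝ} (ht : 1 / 2 ≤ t) :
    (γ.trans γ').ext t = γ'.ext (2 * t - 1) :=
  Path.extend_trans_of_half_le _ _ ht

/-- The inverse path. -/
noncomputable def symm (γ : SmoothPath I x y) : SmoothPath I y x where
  toPath := γ.toPath.symm
  smooth := by
    have key : ContMDiff 𝓘(ℝ, ℝ) I ∞ (fun t => γ.ext (1 - t)) :=
      γ.ext_smooth.comp (f := fun t : ℝ => 1 - t) (ContDiff.contMDiff (by fun_prop))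
    refine (key.comp (contMDiff_subtypeVal_Icc (x := (0 : ℝ)) (y := 1))).congr fun t => ?_
    rw [← Path.extend_extends', Path.extend_symm_apply]
    rfl
  sitting := by
    obtain ⟨ε, e0, e1, h1, h2⟩ := γ.ext_sitting
    refine ⟨ε, e0, e1, fun t ht => ?_, fun t ht => ?_⟩
    · rw [← Path.extend_extends', Path.extend_symm_apply]
      exact h2 _ (by linarith)
    · rw [← Path.extend_extends', Path.extend_symm_apply]
      exact h1 _ (by linarith)

theorem symm_ext (γ : SmoothPath I x y) : γ.symm.ext = fun t => γ.ext (1 - t) :=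
  γ.toPath.extend_symm

/-- The image of a path under a smooth map. -/
noncomputable def map (γ : SmoothPath I x y) {f : M → N} (hf : ContMDiff I I' ∞ f) :
    SmoothPath I' (f x) (f y) where
  toPath := γ.toPath.map hf.continuous
  smooth := hf.comp γ.smooth
  sitting := by
    obtain ⟨ε, e0, e1, h1, h2⟩ := γ.sitting
    exact ⟨ε, e0, e1, fun t ht => congrArg f (h1 t ht), fun t ht => congrArg f (h2 t ht)⟩

theorem map_thin {γ γ' : SmoothPath I x y} (h : ThinHomotopic γ γ') {f : M → N}
    (hf : ContMDiff I I' ∞ f) : ThinHomotopic (γ.map hf) (γ'.map hf) := by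
  obtain ⟨k, hk, ⟨ε, e0, e1, ka, kb, kc, kd⟩, hr⟩ := h
  refine ⟨fun p => f (k p), hf.comp hk, ⟨ε, e0, e1, fun s t ht => congrArg f (ka s t ht),
    fun s t ht => congrArg f (kb s t ht), fun s t ht => congrArg f (kc s t ht),
    fun s t ht => congrArg f (kd s t ht)⟩, fun p => ?_⟩
  have := mfderiv_comp (I := (𝓡∂ 1).prod (𝓡∂ 1)) (I' := I) (I'' := I') p
    ((hf _).mdifferentiableAt (by simp)) ((hk p).mdifferentiableAt (by simp))
  refine Eq.trans_le (congrArg (fun L => LinearMap.rank (ContinuousLinearMap.toLinearMap L))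
    this) ?_
  have h1 := LinearMap.lift_rank_comp_le_right
    (mfderiv ((𝓡∂ 1).prod (𝓡∂ 1)) I k p).toLinearMap (mfderiv I I' f (k p)).toLinearMap
  have h2 : Cardinal.lift (LinearMap.rank (mfderiv ((𝓡∂ 1).prod (𝓡∂ 1)) I k p).toLinearMap) ≤ 1 :=
    Cardinal.lift_le_one_iff.mpr (hr p)
  exact Cardinal.lift_le_one_iff.mp (h1.trans h2)

theorem trans_thin {γ₁ γ₂ : SmoothPath I x y} {γ₁' γ₂' : SmoothPath I y z}
    (h : ThinHomotopic γ₁ γ₂) (h' : ThinHomotopic γ₁' γ₂') :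
    ThinHomotopic (γ₁.trans γ₁') (γ₂.trans γ₂') := by
  obtain ⟨k, hk, ε, e0, ka, kb, kc, kd⟩ := (thinHomotopic_iff _ _).1 h
  obtain ⟨l, hl, δ, d0, la, lb, lc, ld⟩ := (thinHomotopic_iff _ _).1 h'
  have hm : 0 < min (min ε δ) 1 := by positivity
  have m1 : min (min ε δ) 1 ≤ ε := (min_le_left _ _).trans (min_le_left _ _)
  have m2 : min (min ε δ) 1 ≤ δ := (min_le_left _ _).trans (min_le_right _ _)
  have m3 : min (min ε δ) 1 ≤ 1 := min_le_right _ _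
  generalize min (min ε δ) 1 = η at hm m1 m2 m3
  refine (thinHomotopic_iff _ _).2
    ⟨fun p => if p.2 ≤ 1 / 2 then k (p.1, 2 * p.2) else l (p.1, 2 * p.2 - 1), ?_,
      η / 2, by positivity, ?_, ?_, ?_, ?_⟩
  · rintro ⟨s, t⟩
    have c1 : ContinuousAt (fun p : ℝ × ℝ => p.2) (s, t) := continuousAt_snd
    rcases lt_trichotomy t (1 / 2) with hs | hs | hs
    · refine ((hk _).comp (A := fun p => (p.1, 2 * p.2)) (by fun_prop)).congr ?_
      filter_upwards [c1.eventually (Iio_mem_nhds hs)] with p hp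
      rw [if_pos (le_of_lt hp)]
    · refine (thinAt_const y (s, t)).congr ?_
      filter_upwards [c1.eventually (Ioo_mem_nhds (a := 1 / 2 - η / 2) (b := 1 / 2 + η / 2)
        (by linarith) (by linarith))] with p hp
      have h1 := hp.1
      have h2 := hp.2
      split_ifs
      · exact kb _ _ (by linarith)
      · exact la _ _ (by linarith)
    · refine ((hl _).comp (A := fun p => (p.1, 2 * p.2 - 1)) (by fun_prop)).congr ?_
      filter_upwards [c1.eventually (Ioi_mem_nhds hs)] with p hp
      rw [if_neg (not_le_of_gt hp)]
  · intro s t ht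
    dsimp only
    rw [if_pos (by linarith)]
    exact ka _ _ (by linarith)
  · intro s t ht
    dsimp only
    rw [if_neg (by linarith)]
    exact lb _ _ (by linarith)
  · intro s t ht
    dsimp only
    split_ifs with h
    · rw [trans_ext_of_le _ _ h]
      exact kc _ _ (by linarith)
    · rw [trans_ext_of_ge _ _ (by linarith)]
      exact lc _ _ (by linarith)
  · intro s t ht
    dsimp only
    split_ifs with h
    · rw [trans_ext_of_le _ _ h]
      exact kd _ _ (by linarith)
    · rw [trans_ext_of_ge _ _ (by linarith)]
      exact ld _ _ (by linarith)

/-- The reparametrization by a smooth step function. -/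
noncomputable def step (t : ℝ) : ℝ := Real.smoothTransition (3 * t - 1)

theorem step_contDiff : ContDiff ℝ ∞ step := by
  have hT : ContDiff ℝ ∞ Real.smoothTransition := Real.smoothTransition.contDiff
  exact hT.comp (by fun_prop)

theorem step_lo {t : ℝ} (ht : t ≤ 1 / 3) : step t = 0 :=
  Real.smoothTransition.zero_of_nonpos (by linarith)

theorem step_hi {t : ℝ} (ht : 2 / 3 ≤ t) : step t = 1 :=
  Real.smoothTransition.one_of_one_le (by linarith)

/-- A path reparametrized by a smooth step function. -/
noncomputable def slow (γ : SmoothPath I x y) : SmoothPath I x y :=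
  ofLine (fun t => γ.ext (step t))
    (γ.ext_smooth.comp (f := step) step_contDiff.contMDiff)
    ⟨1 / 3, by norm_num, fun t ht => by
      rw [step_lo ht.le]; exact γ.toPath.extend_zero, fun t ht => by
      rw [step_hi (by linarith)]; exact γ.toPath.extend_one⟩

theorem slow_ext (γ : SmoothPath I x y) : γ.slow.ext = fun t => γ.ext (step t) :=
  ofLine_ext _ _

theorem slow_thin (γ : SmoothPath I x y) : ThinHomotopic γ γ.slow := by
  obtain ⟨ε, e0, e1, h1, h2⟩ := γ.ext_sitting
  refine thinHomotopic_of_line γ.ext_smooth contDiff_id step_contDiff rfl γ.slow_ext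
    ⟨min ε (1 / 3), by positivity, fun t ht a ha0 ha1 => ?_, fun t ht a ha0 ha1 => ?_⟩
  · have m1 := min_le_left ε (1 / 3)
    have m2 := min_le_right ε (1 / 3)
    rw [step_lo (by linarith)]
    refine h1 _ ?_
    simp only [id]
    rcases le_total 0 t with h | h <;> nlinarith
  · have m1 := min_le_left ε (1 / 3)
    have m2 := min_le_right ε (1 / 3)
    rw [step_hi (by linarith)]
    refine h2 _ ?_
    simp only [id]
    rcases le_total t 1 with h | h <;> nlinarith

theorem refl_trans_thin (γ : SmoothPath I x y) : ThinHomotopic ((refl x).trans γ) γ := by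
  refine ThinHomotopic.trans (trans_thin (ThinHomotopic.refl _) γ.slow_thin) ?_
  refine ThinHomotopic.trans ?_ γ.slow_thin.symm
  have hs := step_contDiff
  refine thinHomotopic_of_line (φ₀ := fun t => step (2 * t - 1)) (φ₁ := step) γ.ext_smooth
    (hs.comp (by fun_prop)) hs ?_ γ.slow_ext
    ⟨1 / 6, by norm_num, fun t ht a ha0 ha1 => ?_, fun t ht a ha0 ha1 => ?_⟩
  · funext t
    rcases le_total t (1 / 2) with h | h
    · rw [trans_ext_of_le _ _ h, step_lo (by linarith), refl_ext]
      exact γ.toPath.extend_zero.symm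
    · rw [trans_ext_of_ge _ _ h, slow_ext]
  · rw [step_lo (by linarith), step_lo (by linarith)]
    simp only [mul_zero, add_zero]
    exact γ.toPath.extend_zero
  · rw [step_hi (by linarith), step_hi (by linarith)]
    simp only [mul_one, sub_add_cancel]
    exact γ.toPath.extend_one

theorem trans_refl_thin (γ : SmoothPath I x y) : ThinHomotopic (γ.trans (refl y)) γ := by
  refine ThinHomotopic.trans (trans_thin γ.slow_thin (ThinHomotopic.refl _)) ?_
  refine ThinHomotopic.trans ?_ γ.slow_thin.symm
  have hs := step_contDiff
  refine thinHomotopic_of_line (φ₀ := fun t => step (2 * t)) (φ₁ := step) γ.ext_smooth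
    (hs.comp (by fun_prop)) hs ?_ γ.slow_ext
    ⟨1 / 6, by norm_num, fun t ht a ha0 ha1 => ?_, fun t ht a ha0 ha1 => ?_⟩
  · funext t
    rcases le_total t (1 / 2) with h | h
    · rw [trans_ext_of_le _ _ h, slow_ext]
    · rw [trans_ext_of_ge _ _ h, step_hi (by linarith), refl_ext]
      exact γ.toPath.extend_one.symm
  · rw [step_lo (by linarith), step_lo (by linarith)]
    simp only [mul_zero, add_zero]
    exact γ.toPath.extend_zero
  · rw [step_hi (by linarith), step_hi (by linarith)]
    simp only [mul_one, sub_add_cancel]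
    exact γ.toPath.extend_one

theorem symm_trans_thin (γ : SmoothPath I x y) : ThinHomotopic (γ.symm.trans γ) (refl y) := by
  have hs := step_contDiff
  refine ThinHomotopic.trans (trans_thin γ.symm.slow_thin γ.slow_thin) ?_
  refine thinHomotopic_of_line (φ₀ := fun t => 1 - step (2 * t) + step (2 * t - 1))
    (φ₁ := fun _ => 1) γ.ext_smooth
    ((contDiff_const.sub (hs.comp (by fun_prop))).add (hs.comp (by fun_prop))) contDiff_const ?_ ?_
    ⟨1 / 6, by norm_num, fun t ht a ha0 ha1 => ?_, fun t ht a ha0 ha1 => ?_⟩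
  · funext t
    rcases le_total t (1 / 2) with h | h
    · rw [trans_ext_of_le _ _ h, slow_ext, symm_ext, step_lo (t := 2 * t - 1) (by linarith)]
      simp
    · rw [trans_ext_of_ge _ _ h, slow_ext, step_hi (t := 2 * t) (by linarith)]
      simp
  · funext t
    exact γ.toPath.extend_one.symm
  · rw [step_lo (by linarith), step_lo (by linarith)]
    simp only [sub_zero, add_zero, mul_one, sub_add_cancel]
    exact γ.toPath.extend_one
  · rw [step_hi (by linarith), step_hi (by linarith)]
    simp only [sub_self, zero_add, mul_one, sub_add_cancel]
    exact γ.toPath.extend_one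

theorem symm_thin {γ γ' : SmoothPath I x y} (h : ThinHomotopic γ γ') :
    ThinHomotopic γ.symm γ'.symm := by
  obtain ⟨k, hk, ε, e0, ka, kb, kc, kd⟩ := (thinHomotopic_iff _ _).1 h
  refine (thinHomotopic_iff _ _).2 ⟨fun p => k (p.1, 1 - p.2), fun p => ?_, ε, e0, ?_, ?_, ?_, ?_⟩
  · exact (hk _).comp (A := fun p => (p.1, 1 - p.2)) (by fun_prop)
  · exact fun s t ht => kb _ _ (by linarith)
  · exact fun s t ht => ka _ _ (by linarith)
  · intro s t ht
    rw [symm_ext]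
    exact kc _ _ ht
  · intro s t ht
    rw [symm_ext]
    exact kd _ _ ht

theorem symm_symm (γ : SmoothPath I x y) : γ.symm.symm = γ := by
  apply ext_injective
  rw [symm_ext, symm_ext]
  simp

theorem trans_symm_thin (γ : SmoothPath I x y) : ThinHomotopic (γ.trans γ.symm) (refl x) := by
  have := γ.symm.symm_trans_thin
  rwa [symm_symm] at this

theorem assoc_thin (γ₁ : SmoothPath I x y) (γ₂ : SmoothPath I y z) (γ₃ : SmoothPath I z w) :
    ThinHomotopic ((γ₁.trans γ₂).trans γ₃) (γ₁.trans (γ₂.trans γ₃)) := by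
  have hs := step_contDiff
  refine ThinHomotopic.trans (trans_thin (trans_thin γ₁.slow_thin γ₂.slow_thin) γ₃.slow_thin) ?_
  refine ThinHomotopic.trans ?_
    (trans_thin γ₁.slow_thin (trans_thin γ₂.slow_thin γ₃.slow_thin)).symm
  -- the three paths glued along `[0,1]`, `[1,2]`, `[2,3]`
  have hG : ContMDiff 𝓘(ℝ, ℝ) I ∞
      (fun t => ((γ₁.trans γ₂).trans γ₃).ext (if t ≤ 2 then t / 4 else (t - 1) / 2)) := by
    obtain ⟨ε, e0, e1, h1, h2⟩ := γ₃.ext_sitting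
    obtain ⟨δ, d0, d1, h3, h4⟩ := γ₂.ext_sitting
    have hX := ((γ₁.trans γ₂).trans γ₃).ext_smooth
    intro t
    rcases lt_trichotomy t 2 with ht | ht | ht
    · refine (hX.comp (f := fun t : ℝ => t / 4)
        (ContDiff.contMDiff (by fun_prop)) t).congr_of_eventuallyEq ?_
      filter_upwards [Iio_mem_nhds ht] with s hs
      rw [if_pos (le_of_lt hs)]
      rfl
    · refine (contMDiffAt_const (c := z)).congr_of_eventuallyEq ?_
      filter_upwards [Ioo_mem_nhds (a := 2 - δ) (b := 2 + ε)
          (by linarith) (by linarith)] with s hs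
      have hs1 := hs.1
      have hs2 := hs.2
      split_ifs with h
      · rw [trans_ext_of_le _ _ (by linarith), trans_ext_of_ge _ _ (by linarith)]
        exact h4 _ (by linarith)
      · rw [trans_ext_of_ge _ _ (by linarith)]
        exact h1 _ (by linarith)
    · refine (hX.comp (f := fun t : ℝ => (t - 1) / 2)
        (ContDiff.contMDiff (by fun_prop)) t).congr_of_eventuallyEq ?_
      filter_upwards [Ioi_mem_nhds ht] with s hs
      rw [if_neg (not_le_of_gt hs)]
      rfl
  set G : ℝ → M :=
    (fun t => ((γ₁.trans γ₂).trans γ₃).ext (if t ≤ 2 then t / 4 else (t - 1) / 2)) with hGdef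
  have n1 : ∀ t, 0 ≤ step t := fun t => Real.smoothTransition.nonneg _
  have n2 : ∀ t, step t ≤ 1 := fun t => Real.smoothTransition.le_one _
  have g1 : ∀ t, t ≤ 1 → G t = γ₁.ext t := by
    intro t ht
    simp only [hGdef]
    rw [if_pos (by linarith), trans_ext_of_le _ _ (by linarith), trans_ext_of_le _ _ (by linarith)]
    congr 1; ring
  have g2 : ∀ t, 1 ≤ t → t ≤ 2 → G t = γ₂.ext (t - 1) := by
    intro t ht ht'
    simp only [hGdef]
    rw [if_pos (by linarith), trans_ext_of_le _ _ (by linarith), trans_ext_of_ge _ _ (by linarith)]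
    congr 1; ring
  have g3 : ∀ t, 2 ≤ t → G t = γ₃.ext (t - 2) := by
    intro t ht
    rcases eq_or_lt_of_le ht with h | h
    · rw [← h, g2 2 (by norm_num) le_rfl]
      norm_num
      exact γ₂.toPath.extend_one.trans γ₃.toPath.extend_zero.symm
    · simp only [hGdef]
      rw [if_neg (by linarith), trans_ext_of_ge _ _ (by linarith)]
      congr 1; ring
  refine thinHomotopic_of_line
    (φ₀ := fun t => step (4 * t) + step (4 * t - 1) + step (2 * t - 1))
    (φ₁ := fun t => step (2 * t) + step (4 * t - 2) + step (4 * t - 3)) hG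
    (((hs.comp (by fun_prop)).add (hs.comp (by fun_prop))).add (hs.comp (by fun_prop)))
    (((hs.comp (by fun_prop)).add (hs.comp (by fun_prop))).add (hs.comp (by fun_prop))) ?_ ?_
    ⟨1 / 12, by norm_num, fun t ht a ha0 ha1 => ?_, fun t ht a ha0 ha1 => ?_⟩
  · funext t
    rcases le_total t (1 / 2) with h | h
    · rw [trans_ext_of_le _ _ h, step_lo (t := 2 * t - 1) (by linarith), add_zero]
      rcases le_total t (1 / 4) with h' | h'
      · rw [trans_ext_of_le _ _ (by linarith), step_lo (t := 4 * t - 1) (by linarith), add_zero,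
          g1 _ (n2 _), slow_ext]
        ring_nf
      · rw [trans_ext_of_ge _ _ (by linarith), step_hi (t := 4 * t) (by linarith),
          g2 _ (by linarith [n1 (4 * t - 1)]) (by linarith [n2 (4 * t - 1)]), slow_ext]
        ring_nf
    · rw [trans_ext_of_ge _ _ h, step_hi (t := 4 * t) (by linarith),
        step_hi (t := 4 * t - 1) (by linarith), g3 _ (by linarith [n1 (2 * t - 1)]), slow_ext]
      ring_nf
  · funext t
    rcases le_total t (1 / 2) with h | h
    · rw [trans_ext_of_le _ _ h, step_lo (t := 4 * t - 2) (by linarith),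
        step_lo (t := 4 * t - 3) (by linarith), add_zero, add_zero, g1 _ (n2 _), slow_ext]
    · rw [trans_ext_of_ge _ _ h, step_hi (t := 2 * t) (by linarith)]
      rcases le_total t (3 / 4) with h' | h'
      · rw [trans_ext_of_le _ _ (by linarith), step_lo (t := 4 * t - 3) (by linarith), add_zero,
          g2 _ (by linarith [n1 (4 * t - 2)]) (by linarith [n2 (4 * t - 2)]), slow_ext]
        ring_nf
      · rw [trans_ext_of_ge _ _ (by linarith), step_hi (t := 4 * t - 2) (by linarith),
          g3 _ (by linarith [n1 (4 * t - 3)]), slow_ext]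
        ring_nf
  · rw [step_lo (by linarith), step_lo (by linarith), step_lo (by linarith), step_lo (by linarith),
      step_lo (by linarith), step_lo (by linarith)]
    rw [g1 _ (by norm_num)]
    norm_num
    exact γ₁.toPath.extend_zero
  · rw [step_hi (by linarith), step_hi (by linarith), step_hi (by linarith), step_hi (by linarith),
      step_hi (by linarith), step_hi (by linarith)]
    have : (1 - a) * (1 + 1 + 1) + a * (1 + 1 + 1) = (3 : ℝ) := by ring
    rw [this, g3 _ (by norm_num)]
    norm_num
    exact γ₃.toPath.extend_one

end SmoothPath

/-- Thin homotopy is an equivalence relation on the paths `x ⟶ y`. -/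
def thinSetoid (I : ModelWithCorners ℝ E H) (x y : M) : Setoid (SmoothPath I x y) where
  r := ThinHomotopic
  iseqv := ⟨ThinHomotopic.refl, ThinHomotopic.symm, ThinHomotopic.trans⟩

/-! ### The path groupoid -/

/-- The objects of the path groupoid of `M`: the points of `M`. -/
structure PathGroupoid (I : ModelWithCorners ℝ E H) (M : Type*) where
  pt : M

/-- The path groupoid of `M`: morphisms are thin homotopy classes of paths. -/
noncomputable instance : Groupoid (PathGroupoid I M) where
  Hom a b := Quotient (thinSetoid I a.pt b.pt)
  id a := Quotient.mk _ (SmoothPath.refl a.pt)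
  comp f g := Quotient.map₂ SmoothPath.trans (fun _ _ h _ _ h' => SmoothPath.trans_thin h h') f g
  inv f := Quotient.map SmoothPath.symm (fun _ _ h => SmoothPath.symm_thin h) f
  id_comp := by
    rintro a b ⟨γ⟩
    exact Quotient.sound γ.refl_trans_thin
  comp_id := by
    rintro a b ⟨γ⟩
    exact Quotient.sound γ.trans_refl_thin
  assoc := by
    rintro a b c d ⟨γ₁⟩ ⟨γ₂⟩ ⟨γ₃⟩
    exact Quotient.sound (γ₁.assoc_thin γ₂ γ₃)
  inv_comp := by
    rintro a b ⟨γ⟩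
    exact Quotient.sound γ.symm_trans_thin
  comp_inv := by
    rintro a b ⟨γ⟩
    exact Quotient.sound γ.trans_symm_thin

/-- The thin homotopy class of a path, as a morphism of the path groupoid. -/
def SmoothPath.pr {x y : M} (γ : SmoothPath I x y) :
    (PathGroupoid.mk x : PathGroupoid I M) ⟶ PathGroupoid.mk y :=
  Quotient.mk (thinSetoid I x y) γ

/-- The functor of path groupoids induced by a smooth map. -/
noncomputable def PathGroupoid.map {f : M → N} (hf : ContMDiff I I' ∞ f) :
    PathGroupoid I M ⥤ PathGroupoid I' N where
  obj a := ⟨f a.pt⟩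
  map {a b} γ := Quotient.map' (s₁ := thinSetoid I a.pt b.pt)
    (s₂ := thinSetoid I' (f a.pt) (f b.pt)) (fun γ => γ.map hf)
    (fun _ _ h => SmoothPath.map_thin h hf) γ
  map_id _ := rfl
  map_comp := by
    rintro a b c ⟨γ⟩ ⟨γ'⟩
    refine congrArg (Quotient.mk (thinSetoid I' (f a.pt) (f c.pt))) ?_
    apply SmoothPath.ext_injective
    exact congrArg (fun p : Path (f a.pt) (f c.pt) => (p.extend : ℝ → N))
      (Path.map_trans γ.toPath γ'.toPath hf.continuous)

/-- The set of all paths in `M`. -/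
abbrev PathSpace (I : ModelWithCorners ℝ E H) (M : Type*) [TopologicalSpace M]
    [ChartedSpace H M] := Σ x y : M, SmoothPath I x y

/-- Euclidean space of dimension `k`. -/
abbrev Euc (k : ℕ) := EuclideanSpace ℝ (Fin k)

/-- A family of paths parametrized by `U ⊆ ℝᵏ` is smooth if `(u, t) ↦ c(u)(t)` is smooth on
`U × [0,1]`. -/
def SmoothFamilyOn {k : ℕ} (c : Euc k → PathSpace I M) (U : Set (Euc k)) : Prop :=
  ContMDiffOn ((𝓡 k).prod (𝓡∂ 1)) I ∞
    (fun p : Euc k × unitInterval => (c p.1).2.2.toPath p.2) (U ×ˢ univ)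

end Paths

/-! ### Lie groupoids -/

/-- A smooth structure, given by a smooth atlas. The dimension may vary between the components, as
it does for the arrows of `⊔ₙ BU(n)`. -/
class SmoothStructure (X : Type*) [TopologicalSpace X] where
  atlas : Set (Σ n : ℕ, OpenPartialHomeomorph X (Euc n))
  exists_chart : ∀ x, ∃ φ ∈ atlas, x ∈ φ.2.source
  compatible : ∀ φ ∈ atlas, ∀ ψ ∈ atlas,
    ContDiffOn ℝ ∞ (fun u => ψ.2 (φ.2.symm u)) (φ.2.symm.trans ψ.2).source

section Smooth

variable {E : Type*} [NormedAddCommGroup E] [NormedSpace ℝ E]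
  {H : Type*} [TopologicalSpace H]
  {N : Type*} [TopologicalSpace N] [ChartedSpace H N]
  {X : Type*} [TopologicalSpace X] [SmoothStructure X]
  {Y : Type*} [TopologicalSpace Y] [SmoothStructure Y]

/-- Smoothness, on a subset `s`, of a map from a manifold `N` to a space with a smooth
structure. -/
def SmoothOn (I : ModelWithCorners ℝ E H) (f : N → X) (s : Set N) : Prop :=
  ContinuousOn f s ∧ ∀ φ ∈ SmoothStructure.atlas (X := X),
    ContMDiffOn I 𝓘(ℝ, Euc φ.1) ∞ (fun p => φ.2 (f p)) (s ∩ f ⁻¹' φ.2.source)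

/-- A smooth map between spaces with smooth structures. -/
def IsSmoothMap (f : X → Y) : Prop :=
  Continuous f ∧ ∀ φ ∈ SmoothStructure.atlas (X := X), ∀ ψ ∈ SmoothStructure.atlas (X := Y),
    ∀ x ∈ φ.2.source, f x ∈ ψ.2.source →
      ContDiffAt ℝ ∞ (fun u => ψ.2 (f (φ.2.symm u))) (φ.2 x)

/-- A submersion between spaces with smooth structures. -/
def IsSubmersionMap (f : X → Y) : Prop :=
  IsSmoothMap f ∧
    ∀ φ ∈ SmoothStructure.atlas (X := X), ∀ ψ ∈ SmoothStructure.atlas (X := Y),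
      ∀ x ∈ φ.2.source, f x ∈ ψ.2.source →
        Function.Surjective (fderiv ℝ (fun u => ψ.2 (f (φ.2.symm u))) (φ.2 x))

end Smooth

/-- A Lie groupoid: a groupoid whose sets of objects and of arrows carry smooth structures, with
submersive source and target, smooth composition and smooth identities. (Source and target are
surjective because of the identities.) The composition is a map on the set of composable pairs, an
embedded submanifold of the product; a map on it is smooth precisely if it takes every
pair of smooth composable families of arrows over an open subset of some `ℝᵏ` to a smooth
family. -/
class LieGroupoid (Gr : Type*) [Groupoid Gr] [TopologicalSpace Gr] [SmoothStructure Gr]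
    [TopologicalSpace (Arrow Gr)] [SmoothStructure (Arrow Gr)] : Prop where
  source_submersion : IsSubmersionMap (fun f : Arrow Gr => f.left)
  target_submersion : IsSubmersionMap (fun f : Arrow Gr => f.right)
  smooth_comp : ∀ (k : ℕ) (U : Set (Euc k)), IsOpen U → ∀ (f g : Euc k → Arrow Gr)
    (h : ∀ u, (f u).right = (g u).left), SmoothOn (𝓡 k) f U → SmoothOn (𝓡 k) g U →
      SmoothOn (𝓡 k) (fun u => Arrow.mk ((f u).hom ≫ eqToHom (h u) ≫ (g u).hom)) U
  smooth_id : IsSmoothMap (fun a : Gr => Arrow.mk (𝟙 a))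

/-! ### Transport functors -/

section Transport

variable {E : Type*} [NormedAddCommGroup E] [NormedSpace ℝ E]
  {H : Type*} [TopologicalSpace H] {I : ModelWithCorners ℝ E H}
  {M : Type*} [TopologicalSpace M] [ChartedSpace H M]
  {E' : Type*} [NormedAddCommGroup E'] [NormedSpace ℝ E']
  {H' : Type*} [TopologicalSpace H'] {I' : ModelWithCorners ℝ E' H'}
  {Y : Type*} [TopologicalSpace Y] [ChartedSpace H' Y]
  {Gr : Type*} [Groupoid Gr] [TopologicalSpace Gr] [SmoothStructure Gr]
  [TopologicalSpace (Arrow Gr)] [SmoothStructure (Arrow Gr)]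
  {T : Type*} [Category T]

/-- A functor from the path groupoid to a Lie groupoid is smooth if it is smooth on points and
takes smooth families of paths to smooth families of arrows. -/
def IsSmoothFunctor (F : PathGroupoid I M ⥤ Gr) : Prop :=
  SmoothOn I (fun x : M => F.obj ⟨x⟩) univ ∧
    ∀ (k : ℕ) (U : Set (Euc k)), IsOpen U → ∀ c : Euc k → PathSpace I M, SmoothFamilyOn c U →
      SmoothOn (𝓡 k) (fun u => Arrow.mk (F.map (c u).2.2.pr)) U

/-- A `π`-local `i`-trivialization of a functor `F` on the path groupoid of `M`. -/
structure LocalTrivialization (i : Gr ⥤ T) (F : PathGroupoid I M ⥤ T) (π : Y → M)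
    (hπ : ContMDiff I' I ∞ π) where
  triv : PathGroupoid I' Y ⥤ Gr
  t : PathGroupoid.map hπ ⋙ F ≅ triv ⋙ i

/-- The fibre product `Y ×_M Y`. -/
abbrev FibreProduct (π : Y → M) := {p : Y × Y // π p.1 = π p.2}

namespace LocalTrivialization

variable {i : Gr ⥤ T} {F : PathGroupoid I M ⥤ T} {π : Y → M} {hπ : ContMDiff I' I ∞ π}

/-- The component `g(α) = t(y') ∘ t(y)⁻¹` at `α = (y, y')` of the descent datum `g` extracted from
a local trivialization. -/
noncomputable def transition (L : LocalTrivialization i F π hπ) (α : FibreProduct π) :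
    i.obj (L.triv.obj ⟨α.1.1⟩) ⟶ i.obj (L.triv.obj ⟨α.1.2⟩) :=
  L.t.inv.app ⟨α.1.1⟩ ≫
    eqToHom (congrArg (fun m => F.obj (PathGroupoid.mk m)) α.2) ≫ L.t.hom.app ⟨α.1.2⟩

/-- Smoothness of the descent data `(triv, g)` of a local trivialization: `triv` is a smooth
functor, and `g` is the image under `i` of a smooth natural equivalence
`g' : π₁^* triv ⟶ π₂^* triv` on the path groupoid of `Y ×_M Y`. A path in `Y ×_M Y` is a
pair of paths in `Y` with the same projection to `M`. Since `Y ×_M Y` is an embedded submanifold of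
`Y × Y`, a map on it is smooth precisely if its composition with every smooth map from an open
subset of some `ℝᵏ` to `Y × Y` with values in `Y ×_M Y` is smooth. -/
def HasSmoothDescent (L : LocalTrivialization i F π hπ) : Prop :=
  IsSmoothFunctor L.triv ∧
    ∃ g' : ∀ α : FibreProduct π, L.triv.obj ⟨α.1.1⟩ ⟶ L.triv.obj ⟨α.1.2⟩,
      (∀ (α β : FibreProduct π) (γ₁ : SmoothPath I' α.1.1 β.1.1) (γ₂ : SmoothPath I' α.1.2 β.1.2),
        (∀ s, π (γ₁.toPath s) = π (γ₂.toPath s)) →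
          L.triv.map γ₁.pr ≫ g' β = g' α ≫ L.triv.map γ₂.pr) ∧
      (∀ (k : ℕ) (U : Set (Euc k)), IsOpen U → ∀ c : Euc k → FibreProduct π,
        ContMDiffOn (𝓡 k) (I'.prod I') ∞ (fun u => (c u).1) U →
          SmoothOn (𝓡 k) (fun u => Arrow.mk (g' (c u))) U) ∧
      ∀ α, i.map (g' α) = L.transition α

end LocalTrivialization

/-- A functor `F` on the path groupoid of the `d`-dimensional manifold `M` is a transport functor
with `Gr`-structure if for some surjective submersion `π : Y → M` it has a `π`-local
`i`-trivialization with smooth descent data. -/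
def IsTransportFunctor.{u} {d : ℕ} {M : Type u} [TopologicalSpace M] [ChartedSpace (Euc d) M]
    (i : Gr ⥤ T) (F : PathGroupoid (𝓡 d) M ⥤ T) : Prop :=
  ∃ (e : ℕ) (Y : Type u) (_ : TopologicalSpace Y) (_ : ChartedSpace (Euc e) Y),
    T2Space Y ∧ SecondCountableTopology Y ∧ IsManifold (𝓡 e) ∞ Y ∧
    ∃ π : Y → M, Function.Surjective π ∧ ∃ hπ : Manifold.IsSubmersion (𝓡 e) (𝓡 d) ∞ π,
      ∃ L : LocalTrivialization i F π hπ.contMDiff, L.HasSmoothDescent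

/-! ### Wilson lines -/

/-- The choices of objects `G₁`, `G₂` and of isomorphisms `t₁`, `t₂` that enter the Wilson line of
`F` from `x₁` to `x₂`. -/
structure WilsonChoice (i : Gr ⥤ T) (F : PathGroupoid I M ⥤ T) (x₁ x₂ : M) where
  G₁ : Gr
  G₂ : Gr
  t₁ : F.obj ⟨x₁⟩ ≅ i.obj G₁
  t₂ : F.obj ⟨x₂⟩ ≅ i.obj G₂

namespace WilsonChoice

variable {i : Gr ⥤ T} {F : PathGroupoid I M ⥤ T} {x₁ x₂ : M}

/-- The Wilson line of `F` from `x₁` to `x₂`, which takes the class of `γ` to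
`i⁻¹(t₂ ∘ F(γ) ∘ t₁⁻¹)`. -/
noncomputable def wilsonLine [i.IsEquivalence] (w : WilsonChoice i F x₁ x₂)
    (γ : (PathGroupoid.mk x₁ : PathGroupoid I M) ⟶ PathGroupoid.mk x₂) : w.G₁ ⟶ w.G₂ :=
  i.preimage (w.t₁.inv ≫ F.map γ ≫ w.t₂.hom)

/-- The Wilson line is smooth if it takes smooth families of paths from `x₁` to `x₂`, over open
subsets of Euclidean spaces, to smooth families of arrows of `Gr`. -/
def IsSmooth [i.IsEquivalence] (w : WilsonChoice i F x₁ x₂) : Prop :=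
  ∀ (k : ℕ) (U : Set (Euc k)), IsOpen U → ∀ c : Euc k → SmoothPath I x₁ x₂,
    SmoothFamilyOn (fun u => ⟨x₁, x₂, c u⟩) U →
      SmoothOn (𝓡 k) (fun u => Arrow.mk (w.wilsonLine (c u).pr)) U

end WilsonChoice

end Transport

end ParallelTransport

/-! The choices in a Wilson line do not matter: other choices compose it on both sides with fixed
arrows of `Gr`, and composition in `Gr` is smooth (`WilsonChoice.IsSmooth.change`).

From Wilson lines to a transport functor. Cover `M` by countably many coordinate balls `O j` with
centres `m j`, and let `Y` be their disjoint union. At a point `(x, j)` of `Y`, trivialize `F` by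
going back along the radial path to `m j` and applying a fixed isomorphism there. In these
trivializations, `F` on a path `γ` from `O j` to `O j'` is the Wilson line from `m j` to `m j'` of
the path "radial, then `γ`, then radial backwards". This composite depends smoothly on parameters,
so its Wilson line does too (`RadialCover.smoothOn_arrow`). The functor `triv` is the case where `γ`
is projected from `Y`, and the transition `g'` is the case of a constant `γ`; both parts of the
descent data are thus smooth for one reason.

From a transport functor to Wilson lines. A submersion has local sections (`exists_local_section`).
Given a smooth family `c` and a parameter `u₀`, cut `[0,1]` so that `c u₀` maps each piece into the
domain of a section; by compactness the same holds for `c u` with `u` near `u₀`. Along each piece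
`F` is represented by `triv` of the lifted piece, and where two lifts meet they differ by the
transition `g'`. The Wilson line is locally a finite composite of smooth families of arrows
(`smoothOn_extend`, `smoothOn_change`, and the induction in
`LocalTrivialization.HasSmoothDescent.smoothOn_arrow`).

The sitting instants of a smooth family need not be uniform in the parameter. Paths are therefore
slowed down by one fixed step function before they are cut or concatenated; this leaves their thin
homotopy classes unchanged. -/

namespace ParallelTransport

/-! ### Smooth maps into a space with a smooth structure -/

section SmoothOn

variable {E : Type*} [NormedAddCommGroup E] [NormedSpace ℝ E]
  {H : Type*} [TopologicalSpace H] {I : ModelWithCorners ℝ E H}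
  {N : Type*} [TopologicalSpace N] [ChartedSpace H N]
  {X : Type*} [TopologicalSpace X] [SmoothStructure X]

theorem SmoothOn.mono {f : N → X} {s t : Set N} (h : SmoothOn I f t) (hst : s ⊆ t) :
    SmoothOn I f s :=
  ⟨h.1.mono hst, fun φ hφ => (h.2 φ hφ).mono (inter_subset_inter_left _ hst)⟩

theorem SmoothOn.congr {f g : N → X} {s : Set N} (h : SmoothOn I f s) (hfg : EqOn g f s) :
    SmoothOn I g s := by
  refine ⟨h.1.congr hfg, fun φ hφ => ?_⟩
  have : s ∩ g ⁻¹' φ.2.source = s ∩ f ⁻¹' φ.2.source := by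
    ext p
    constructor
    · rintro ⟨h1, h2⟩
      exact ⟨h1, by simpa [hfg h1] using h2⟩
    · rintro ⟨h1, h2⟩
      exact ⟨h1, by simpa [hfg h1] using h2⟩
  rw [this]
  exact (h.2 φ hφ).congr fun p hp => by rw [hfg hp.1]

theorem smoothOn_const (x : X) (s : Set N) : SmoothOn I (fun _ : N => x) s :=
  ⟨continuousOn_const, fun _ _ => contMDiffOn_const⟩

/-- Smoothness on an open set is a local property. -/
theorem smoothOn_of_locally {f : N → X} {s : Set N}
    (h : ∀ x ∈ s, ∃ V, IsOpen V ∧ x ∈ V ∧ SmoothOn I f (s ∩ V)) : SmoothOn I f s := by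
  constructor
  · exact continuousOn_of_locally_continuousOn fun x hx => by
      obtain ⟨V, h1, h2, h3⟩ := h x hx
      exact ⟨V, h1, h2, h3.1⟩
  · intro φ hφ
    refine contMDiffOn_of_locally_contMDiffOn fun x hx => ?_
    obtain ⟨V, h1, h2, h3⟩ := h x hx.1
    refine ⟨V, h1, h2, (h3.2 φ hφ).mono ?_⟩
    rintro p ⟨⟨a, b⟩, c⟩
    exact ⟨⟨a, c⟩, b⟩

end SmoothOn

/-! ### Smooth families of arrows -/

section Arrows

variable {Gr : Type*} [Groupoid Gr] [TopologicalSpace Gr] [SmoothStructure Gr]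
  [TopologicalSpace (Arrow Gr)] [SmoothStructure (Arrow Gr)] [LieGroupoid Gr]

/-- The composition of smooth families of arrows is smooth. -/
theorem SmoothOn.arrow_comp {k : ℕ} {U : Set (Euc k)} (hU : IsOpen U) {f g r : Euc k → Arrow Gr}
    (hf : SmoothOn (𝓡 k) f U) (hg : SmoothOn (𝓡 k) g U)
    (hr : ∀ u ∈ U, ∃ (a b c : Gr) (p : a ⟶ b) (q : b ⟶ c),
      f u = Arrow.mk p ∧ g u = Arrow.mk q ∧ r u = Arrow.mk (p ≫ q)) : SmoothOn (𝓡 k) r U := by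
  classical
  rcases U.eq_empty_or_nonempty with rfl | ⟨u₀, hu₀⟩
  · exact ⟨continuousOn_empty _, fun φ _ => by simp [ContMDiffOn]⟩
  obtain ⟨a₀, -⟩ := hr u₀ hu₀
  -- `smooth_comp` asks for composability at every parameter, also outside `U`; there both families
  -- are replaced by one identity arrow.
  set f' : Euc k → Arrow Gr := fun u => if u ∈ U then f u else Arrow.mk (𝟙 a₀) with hf'
  set g' : Euc k → Arrow Gr := fun u => if u ∈ U then g u else Arrow.mk (𝟙 a₀) with hg'
  have key : ∀ u, (f' u).right = (g' u).left := by
    intro u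
    by_cases hu : u ∈ U
    · obtain ⟨a, b, c, p, q, h1, h2, -⟩ := hr u hu
      simp only [hf', hg', if_pos hu, h1, h2]
      rfl
    · simp only [hf', hg', if_neg hu]
      rfl
  have := LieGroupoid.smooth_comp k U hU f' g' key (hf.congr fun u hu => if_pos hu)
    (hg.congr fun u hu => if_pos hu)
  refine this.congr fun u hu => ?_
  obtain ⟨a, b, c, p, q, h1, h2, h3⟩ := hr u hu
  -- With `x` and `y` as variables their equations can be substituted, which turns the `eqToHom`
  -- into an identity.
  have aux : ∀ (x y : Arrow Gr) (h : x.right = y.left), x = Arrow.mk p → y = Arrow.mk q →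
      Arrow.mk (p ≫ q) = Arrow.mk (x.hom ≫ eqToHom h ≫ y.hom) := by
    rintro _ _ h rfl rfl
    simp
  dsimp only
  rw [h3]
  exact aux _ _ _ ((if_pos hu).trans h1) ((if_pos hu).trans h2)

end Arrows

/-! ### Smooth families of curves, reparametrization and concatenation -/

section Families

variable {E : Type*} [NormedAddCommGroup E] [NormedSpace ℝ E]
  {H : Type*} [TopologicalSpace H] {I : ModelWithCorners ℝ E H}
  {M : Type*} [TopologicalSpace M] [ChartedSpace H M]
  {k : ℕ} {U : Set (Euc k)}

/-- A family of curves on the real line, parametrized by `U ⊆ ℝᵏ`, is smooth if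
`(u, t) ↦ f u t` is smooth on `U × ℝ`. -/
def SmoothLineFamilyOn (I : ModelWithCorners ℝ E H) (f : Euc k → ℝ → M) (U : Set (Euc k)) : Prop :=
  ContMDiffOn ((𝓡 k).prod 𝓘(ℝ, ℝ)) I ∞ (fun p : Euc k × ℝ => f p.1 p.2) (U ×ˢ univ)

theorem SmoothLineFamilyOn.mono {f : Euc k → ℝ → M} {V : Set (Euc k)}
    (h : SmoothLineFamilyOn I f U) (hV : V ⊆ U) : SmoothLineFamilyOn I f V :=
  ContMDiffOn.mono h (prod_mono hV subset_rfl)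

/-- Curves may be reparametrized. -/
theorem SmoothLineFamilyOn.reparam {f : Euc k → ℝ → M} (h : SmoothLineFamilyOn I f U)
    {φ : ℝ → ℝ} (hφ : ContDiff ℝ ∞ φ) : SmoothLineFamilyOn I (fun u t => f u (φ t)) U := by
  have : ContMDiff ((𝓡 k).prod 𝓘(ℝ, ℝ)) ((𝓡 k).prod 𝓘(ℝ, ℝ)) ∞
      (fun p : Euc k × ℝ => (p.1, φ p.2)) :=
    contMDiff_fst.prodMk (hφ.contMDiff.comp contMDiff_snd)
  exact ContMDiffOn.comp h this.contMDiffOn fun p hp => ⟨hp.1, mem_univ _⟩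

theorem SmoothLineFamilyOn.eval {f : Euc k → ℝ → M} (h : SmoothLineFamilyOn I f U) (t : ℝ) :
    ContMDiffOn (𝓡 k) I ∞ (fun u => f u t) U := by
  have : ContMDiff (𝓡 k) ((𝓡 k).prod 𝓘(ℝ, ℝ)) ∞ (fun u : Euc k => (u, t)) :=
    contMDiff_id.prodMk contMDiff_const
  exact ContMDiffOn.comp h this.contMDiffOn fun p hp => ⟨hp, mem_univ _⟩

/-- Paths whose extensions to the real line are smooth families form a smooth family. -/
theorem SmoothLineFamilyOn.smoothFamilyOn {c : Euc k → PathSpace I M}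
    (h : SmoothLineFamilyOn I (fun u => (c u).2.2.ext) U) : SmoothFamilyOn c U := by
  have : ContMDiff ((𝓡 k).prod (𝓡∂ 1)) ((𝓡 k).prod 𝓘(ℝ, ℝ)) ∞
      (fun p : Euc k × unitInterval => (p.1, (p.2 : ℝ))) :=
    contMDiff_fst.prodMk (contMDiff_subtypeVal_Icc.comp contMDiff_snd)
  refine (ContMDiffOn.comp h this.contMDiffOn fun p hp => ⟨hp.1, mem_univ _⟩).congr fun p _ => ?_
  exact (SmoothPath.ext_coe _ _).symm

/-- A smooth family of paths, reparametrized by a smooth map with values in `[0,1]`. -/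
theorem SmoothFamilyOn.reparam {c : Euc k → PathSpace I M} (h : SmoothFamilyOn c U)
    {φ : ℝ → ℝ} (hφ : ContDiff ℝ ∞ φ) (h01 : ∀ t, φ t ∈ Icc (0 : ℝ) 1) :
    SmoothLineFamilyOn I (fun u t => (c u).2.2.ext (φ t)) U := by
  have h1 : ContMDiff 𝓘(ℝ, ℝ) (𝓡∂ 1) ∞ (fun t => projIcc (0 : ℝ) 1 zero_le_one (φ t)) := by
    rw [← contMDiffOn_univ]
    -- `projIcc` is not smooth across `0` and `1`, but it is smooth on `[0,1]`, where `φ` takes its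
    -- values. Hence no uniform bound on the sitting instants of the family is needed.
    exact contMDiffOn_projIcc.comp hφ.contMDiff.contMDiffOn fun t _ => h01 t
  have : ContMDiff ((𝓡 k).prod 𝓘(ℝ, ℝ)) ((𝓡 k).prod (𝓡∂ 1)) ∞
      (fun p : Euc k × ℝ => (p.1, projIcc (0 : ℝ) 1 zero_le_one (φ p.2))) :=
    contMDiff_fst.prodMk (h1.comp contMDiff_snd)
  exact ContMDiffOn.comp h this.contMDiffOn fun p hp => ⟨hp.1, mem_univ _⟩

theorem SmoothPath.step_mem (t : ℝ) : SmoothPath.step t ∈ Icc (0 : ℝ) 1 :=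
  ⟨Real.smoothTransition.nonneg _, Real.smoothTransition.le_one _⟩

theorem SmoothPath.ext_zero {x y : M} (γ : SmoothPath I x y) : γ.ext 0 = x := γ.toPath.extend_zero

theorem SmoothPath.ext_one {x y : M} (γ : SmoothPath I x y) : γ.ext 1 = y := γ.toPath.extend_one

/-- Slowed down paths can be concatenated in smooth families. -/
theorem SmoothLineFamilyOn.concat {f g h : Euc k → ℝ → M} (hf : SmoothLineFamilyOn I f U)
    (hg : SmoothLineFamilyOn I g U)
    (hh : ∀ u ∈ U, ∃ (x y z : M) (p : SmoothPath I x y) (q : SmoothPath I y z),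
      p.slow.ext = f u ∧ q.slow.ext = g u ∧ h u = (p.slow.trans q.slow).ext) :
    SmoothLineFamilyOn I h U := by
  have h1 := hf.reparam (φ := fun t => 2 * t) (by fun_prop)
  have h2 := hg.reparam (φ := fun t => 2 * t - 1) (by fun_prop)
  refine contMDiffOn_of_locally_contMDiffOn fun w hw => ?_
  -- The half-lines `t < 2/3` and `t > 1/2` overlap around the junction. For `1/2 ≤ t < 2/3` the
  -- first slowed path has already stopped and the second has not yet started, so `f u (2 * t)` is
  -- the correct value on all of `t < 2/3`.
  rcases lt_or_ge w.2 (2 / 3) with hlt | hge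
  · refine ⟨univ ×ˢ Iio (2 / 3), isOpen_univ.prod isOpen_Iio, ⟨mem_univ _, hlt⟩, ?_⟩
    refine (ContMDiffOn.mono h1 inter_subset_left).congr ?_
    rintro ⟨u, t⟩ ⟨⟨hu, -⟩, -, ht⟩
    have ht : t < 2 / 3 := ht
    obtain ⟨x, y, z, p, q, e1, e2, e3⟩ := hh u hu
    dsimp only
    rw [e3, ← e1]
    rcases le_total t (1 / 2) with h' | h'
    · rw [SmoothPath.trans_ext_of_le _ _ h']
    · rw [SmoothPath.trans_ext_of_ge _ _ h', SmoothPath.slow_ext, SmoothPath.slow_ext]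
      dsimp only
      rw [SmoothPath.step_lo (by linarith), SmoothPath.step_hi (t := 2 * t) (by linarith),
        SmoothPath.ext_zero, SmoothPath.ext_one]
  · refine ⟨univ ×ˢ Ioi (1 / 2), isOpen_univ.prod isOpen_Ioi, ⟨mem_univ _, ?_⟩, ?_⟩
    · exact lt_of_lt_of_le (by norm_num) hge
    refine (ContMDiffOn.mono h2 inter_subset_left).congr ?_
    rintro ⟨u, t⟩ ⟨⟨hu, -⟩, -, ht⟩
    have ht : 1 / 2 < t := ht
    obtain ⟨x, y, z, p, q, e1, e2, e3⟩ := hh u hu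
    dsimp only
    rw [e3, ← e2, SmoothPath.trans_ext_of_ge _ _ ht.le]

end Families

/-! ### Subdivision of paths up to thin homotopy -/

section Classes

variable {E : Type*} [NormedAddCommGroup E] [NormedSpace ℝ E]
  {H : Type*} [TopologicalSpace H] {I : ModelWithCorners ℝ E H}
  {M : Type*} [TopologicalSpace M] [ChartedSpace H M]

namespace SmoothPath

variable {x y z : M}

theorem pr_slow (γ : SmoothPath I x y) : γ.slow.pr = γ.pr := Quotient.sound γ.slow_thin.symm

theorem pr_trans (γ : SmoothPath I x y) (γ' : SmoothPath I y z) :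
    (γ.trans γ').pr = γ.pr ≫ γ'.pr := rfl

theorem pr_symm (γ : SmoothPath I x y) : γ.symm.pr = Groupoid.inv γ.pr := rfl

/-- The piece of a path between the times `a` and `b`, slowed down at the ends. -/
noncomputable def segment (γ : SmoothPath I x y) (a b : ℝ) : SmoothPath I (γ.ext a) (γ.ext b) :=
  ofLine (fun t => γ.ext (a + step t * (b - a)))
    (γ.ext_smooth.comp (f := fun t => a + step t * (b - a)) (ContDiff.contMDiff (by
      have := step_contDiff
      fun_prop)))
    ⟨1 / 3, by norm_num, fun t ht => by rw [step_lo ht.le]; simp,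
      fun t ht => by rw [step_hi (by linarith)]; simp⟩

theorem segment_ext (γ : SmoothPath I x y) (a b : ℝ) :
    (γ.segment a b).ext = fun t => γ.ext (a + step t * (b - a)) :=
  ofLine_ext _ _

/-- Both sides run along the one curve `γ.ext`, with parameters that go from `a` to `c`. The
straight homotopy between the parameters is constant near the ends, and it is thin because it
factors through a line. The order of `a`, `b`, `c` plays no role. -/
theorem segment_comp (γ : SmoothPath I x y) (a b c : ℝ) :
    (γ.segment a b).pr ≫ (γ.segment b c).pr = (γ.segment a c).pr := by
  have hs := step_contDiff
  have h2 : ContDiff ℝ ∞ (fun t => step (2 * t)) := hs.comp (by fun_prop)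
  have h3 : ContDiff ℝ ∞ (fun t => step (2 * t - 1)) := hs.comp (by fun_prop)
  refine Quotient.sound ?_
  refine thinHomotopic_of_line
    (φ₀ := fun t => a + step (2 * t) * (b - a) + step (2 * t - 1) * (c - b))
    (φ₁ := fun t => a + step t * (c - a)) γ.ext_smooth (by fun_prop) (by fun_prop) ?_
    (γ.segment_ext a c) ⟨1 / 6, by norm_num, fun t ht s _ _ => ?_, fun t ht s _ _ => ?_⟩
  · funext t
    rcases le_total t (1 / 2) with h | h
    · rw [trans_ext_of_le _ _ h, segment_ext, step_lo (t := 2 * t - 1) (by linarith)]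
      simp
    · rw [trans_ext_of_ge _ _ h, segment_ext, step_hi (t := 2 * t) (by linarith)]
      simp
  · rw [step_lo (by linarith), step_lo (by linarith), step_lo (by linarith)]
    congr 1
    ring
  · rw [step_hi (by linarith), step_hi (by linarith), step_hi (by linarith)]
    congr 1
    ring

end SmoothPath

end Classes

/-! ### Manifold structures pulled back along local homeomorphisms -/

section LocalHomeomorph

variable {d : ℕ} {M : Type*} [TopologicalSpace M] [ChartedSpace (Euc d) M]
  {Y : Type*} [TopologicalSpace Y] {f : Y → M}

/-- The charted space structure pulled back along a local homeomorphism. -/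
noncomputable abbrev pullbackChartedSpace (hf : IsLocalHomeomorph f) : ChartedSpace (Euc d) Y where
  atlas := {e | ∃ y, e = (hf y).choose.trans (chartAt (Euc d) (f y))}
  chartAt y := (hf y).choose.trans (chartAt (Euc d) (f y))
  mem_chart_source y := by
    obtain ⟨h1, h2⟩ := (hf y).choose_spec
    rw [OpenPartialHomeomorph.trans_source]
    refine ⟨h1, ?_⟩
    rw [mem_preimage, ← congrFun h2 y]
    exact mem_chart_source _ _
  chart_mem_atlas y := ⟨y, rfl⟩

/-- The local homeomorphisms underlying two pulled-back charts are both given by `f`, so they cancel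
in a change of charts; what remains is a restriction of a change of charts of `M`. -/
theorem isManifold_pullback [IsManifold (𝓡 d) ∞ M] (hf : IsLocalHomeomorph f) :
    letI := pullbackChartedSpace (d := d) hf
    IsManifold (𝓡 d) ∞ Y := by
  let _ := pullbackChartedSpace (d := d) hf
  refine isManifold_of_contDiffOn _ _ _ ?_
  rintro _ _ ⟨y, rfl⟩ ⟨y', rfl⟩
  have h1 := (hf y).choose_spec.2
  have h2 := (hf y').choose_spec.2
  generalize (hf y).choose = e at *
  generalize (hf y').choose = e' at *
  have key := contMDiffOn_of_mem_contDiffGroupoid (StructureGroupoid.compatible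
    (contDiffGroupoid ∞ (𝓡 d)) (chart_mem_atlas (Euc d) (f y)) (chart_mem_atlas (Euc d) (f y')))
  rw [contMDiffOn_iff_contDiffOn] at key
  generalize chartAt (Euc d) (f y) = φ at *
  generalize chartAt (Euc d) (f y') = φ' at *
  have proj : ∀ v ∈ ((e.trans φ).symm.trans (e'.trans φ')).source,
      f (e.symm (φ.symm v)) = φ.symm v := by
    intro v hv
    simp only [mfld_simps] at hv
    rw [congrFun h1]
    exact e.right_inv hv.1.2
  refine (key.mono ?_).congr ?_
  · rintro v ⟨hv, -⟩
    have hv : v ∈ ((e.trans φ).symm.trans (e'.trans φ')).source := hv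
    have hp := proj v hv
    simp only [mfld_simps] at hv
    refine ⟨hv.1.1, ?_⟩
    have := hv.2.2
    rw [← congrFun h2, hp] at this
    exact this
  · rintro v ⟨hv, -⟩
    change φ' (e' (e.symm (φ.symm v))) = φ' (φ.symm v)
    rw [← congrFun h2, proj v hv]

/-- In the pulled-back charts `f` is the identity map, which is the normal form of a submersion with
the zero space `PUnit` as complement. -/
theorem isSubmersion_pullback [IsManifold (𝓡 d) ∞ M] (hf : IsLocalHomeomorph f) :
    letI := pullbackChartedSpace (d := d) hf
    Manifold.IsSubmersion (𝓡 d) (𝓡 d) ∞ f := by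
  let _ := pullbackChartedSpace (d := d) hf
  have : IsManifold (𝓡 d) ∞ Y := isManifold_pullback hf
  refine ⟨PUnit, inferInstance, inferInstance, fun y => ?_⟩
  refine Manifold.IsSubmersionAtOfComplement.mk_of_charts
    (ContinuousLinearEquiv.prodUnique ℝ (Euc d) PUnit).symm (chartAt (Euc d) y)
    (chartAt (Euc d) (f y)) (mem_chart_source _ _) (mem_chart_source _ _)
    (IsManifold.chart_mem_maximalAtlas _) (IsManifold.chart_mem_maximalAtlas _) ?_ ?_
  · have aux : ∀ (e : OpenPartialHomeomorph Y M) (φ : OpenPartialHomeomorph M (Euc d)),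
        f = e → (e.trans φ).source ⊆ f ⁻¹' φ.source := by
      rintro e φ he z hz
      rw [OpenPartialHomeomorph.trans_source] at hz
      rw [mem_preimage, congrFun he]
      exact hz.2
    exact aux _ _ (hf y).choose_spec.2
  · have aux : ∀ (e : OpenPartialHomeomorph Y M) (φ : OpenPartialHomeomorph M (Euc d)),
        f = e → ∀ v ∈ (e.trans φ).target, φ (f ((e.trans φ).symm v)) = v := by
      rintro e φ he v hv
      rw [OpenPartialHomeomorph.trans_target] at hv
      change φ (f (e.symm (φ.symm v))) = v
      rw [congrFun he, e.right_inv hv.2, φ.right_inv hv.1]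
    intro v hv
    have hv' : v ∈ (chartAt (Euc d) y).target := by simpa using hv
    exact aux _ _ (hf y).choose_spec.2 v hv'

end LocalHomeomorph

/-- Around every point `m` of a manifold, paths from `m` to nearby points can be chosen in a
smooth way. -/
theorem exists_radial_paths {d : ℕ} {M : Type*} [TopologicalSpace M] [ChartedSpace (Euc d) M]
    [IsManifold (𝓡 d) ∞ M] (m : M) :
    ∃ (O : Set M) (r : ∀ x ∈ O, SmoothPath (𝓡 d) m x) (ρ : M → ℝ → M), IsOpen O ∧ m ∈ O ∧
      ContMDiffOn ((𝓡 d).prod 𝓘(ℝ, ℝ)) (𝓡 d) ∞ (fun p : M × ℝ => ρ p.1 p.2) (O ×ˢ univ) ∧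
      ∀ x (hx : x ∈ O), (r x hx).ext = ρ x := by
  set φ := chartAt (Euc d) m with hφ
  have hm : m ∈ φ.source := mem_chart_source _ _
  obtain ⟨R, R0, hR⟩ := Metric.isOpen_iff.1 φ.open_target (φ m) (φ.map_source hm)
  -- In the chart, the straight segment from `φ m` to `φ x`, traversed with the step function. `ρ`
  -- is defined for all `x`, so that joint smoothness can be stated without membership proofs; `O`
  -- is cut out by a ball so that the segments stay in the chart.
  set ρ : M → ℝ → M := fun x t => φ.symm (φ m + SmoothPath.step t • (φ x - φ m)) with hρ
  set O : Set M := φ.source ∩ φ ⁻¹' Metric.ball (φ m) R with hO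
  have mem : ∀ x ∈ O, ∀ t, φ m + SmoothPath.step t • (φ x - φ m) ∈ φ.target := by
    intro x hx t
    apply hR
    have h1 := SmoothPath.step_mem t
    have h2 : ‖φ x - φ m‖ < R := by simpa [dist_eq_norm] using hx.2
    rw [Metric.mem_ball, dist_eq_norm, add_sub_cancel_left, norm_smul, Real.norm_eq_abs,
      abs_of_nonneg h1.1]
    exact (mul_le_of_le_one_left (norm_nonneg _) h1.2).trans_lt h2
  have sm : ContMDiffOn ((𝓡 d).prod 𝓘(ℝ, ℝ)) (𝓡 d) ∞ (fun p : M × ℝ => ρ p.1 p.2)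
      (O ×ˢ univ) := by
    have h1 : ContMDiffOn (𝓡 d) (𝓡 d) ∞ φ O :=
      (contMDiffOn_chart (I := 𝓡 d) (n := ∞) (x := m)).mono inter_subset_left
    have h2 : ContMDiffOn ((𝓡 d).prod 𝓘(ℝ, ℝ)) (𝓡 d) ∞ (fun p : M × ℝ => φ p.1) (O ×ˢ univ) :=
      h1.comp contMDiffOn_fst fun p hp => hp.1
    have h3 : ContMDiffOn ((𝓡 d).prod 𝓘(ℝ, ℝ)) 𝓘(ℝ, ℝ) ∞
        (fun p : M × ℝ => SmoothPath.step p.2) (O ×ˢ univ) :=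
      (SmoothPath.step_contDiff.contMDiff.comp contMDiff_snd).contMDiffOn
    have h4 : ContMDiffOn ((𝓡 d).prod 𝓘(ℝ, ℝ)) (𝓡 d) ∞
        (fun p : M × ℝ => φ m + SmoothPath.step p.2 • (φ p.1 - φ m)) (O ×ˢ univ) :=
      contMDiffOn_const.add (h3.smul (h2.sub contMDiffOn_const))
    exact (contMDiffOn_chart_symm (I := 𝓡 d) (n := ∞) (x := m)).comp h4
      fun p hp => mem p.1 hp.1 p.2
  have line : ∀ x ∈ O, ContMDiff 𝓘(ℝ, ℝ) (𝓡 d) ∞ (ρ x) := fun x hx => by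
    rw [← contMDiffOn_univ]
    exact sm.comp (f := fun t : ℝ => (x, t)) (contMDiff_const.prodMk contMDiff_id).contMDiffOn
      fun t _ => ⟨hx, mem_univ _⟩
  refine ⟨O, fun x hx => SmoothPath.ofLine (ρ x) (line x hx) ⟨1 / 3, by norm_num, ?_, ?_⟩, ρ,
    φ.isOpen_inter_preimage Metric.isOpen_ball, ⟨hm, Metric.mem_ball_self R0⟩, sm,
    fun x hx => SmoothPath.ofLine_ext _ _⟩
  · intro t ht
    simp only [hρ]
    rw [SmoothPath.step_lo ht.le, zero_smul, add_zero, φ.left_inv hm]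
  · intro t ht
    simp only [hρ]
    rw [SmoothPath.step_hi (by linarith), one_smul, add_sub_cancel, φ.left_inv hx.1]

/-! ### Thin classes of paths whose end points agree only propositionally -/

section PathClasses

variable {E : Type*} [NormedAddCommGroup E] [NormedSpace ℝ E]
  {H : Type*} [TopologicalSpace H] {I : ModelWithCorners ℝ E H}
  {M : Type*} [TopologicalSpace M] [ChartedSpace H M]

/-- This lets the transition between two points over the same point of `M` be treated as transport
along a constant path. -/
theorem exists_pr_eq_eqToHom {x y : M} (h : x = y) : ∃ γ : SmoothPath I x y,
    γ.ext = (fun _ => x) ∧ γ.pr = eqToHom (congrArg PathGroupoid.mk h) := by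
  subst h
  exact ⟨SmoothPath.refl x, rfl, rfl⟩

/-- After substitution of the end points the two paths have the same extension, hence are equal. -/
theorem pr_comp_eqToHom {x y x' y' : M} (hx : x = x') (hy : y = y') (γ : SmoothPath I x y)
    (γ' : SmoothPath I x' y') (h : γ.ext = γ'.ext) :
    γ.pr ≫ eqToHom (congrArg PathGroupoid.mk hy) =
      eqToHom (congrArg PathGroupoid.mk hx) ≫ γ'.pr := by
  subst hx hy
  cases SmoothPath.ext_injective h
  simp

end PathClasses

/-! ### Independence of the choices in a Wilson line -/

section Wilson

variable {E : Type*} [NormedAddCommGroup E] [NormedSpace ℝ E]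
  {H : Type*} [TopologicalSpace H] {I : ModelWithCorners ℝ E H}
  {M : Type*} [TopologicalSpace M] [ChartedSpace H M]
  {Gr : Type*} [Groupoid Gr] [TopologicalSpace Gr] [SmoothStructure Gr]
  [TopologicalSpace (Arrow Gr)] [SmoothStructure (Arrow Gr)] [LieGroupoid Gr]
  {T : Type*} [Category T] {i : Gr ⥤ T} [i.IsEquivalence] {F : PathGroupoid I M ⥤ T}

/-- Smoothness of a Wilson line does not depend on the choices that enter it. -/
theorem WilsonChoice.IsSmooth.change {x₁ x₂ : M} {w : WilsonChoice i F x₁ x₂} (hw : w.IsSmooth)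
    (w' : WilsonChoice i F x₁ x₂) : w'.IsSmooth := by
  intro k U hU c hc
  have h1 := hw k U hU c hc
  -- The new Wilson line is the old one composed with two fixed arrows, which `i` sends to
  -- `w'.t₁.inv ≫ w.t₁.hom` and `w.t₂.inv ≫ w'.t₂.hom`; constant families are smooth.
  have h2 := (smoothOn_const (I := 𝓡 k)
    (Arrow.mk (i.preimage (w'.t₁.inv ≫ w.t₁.hom))) U).arrow_comp hU
    (r := fun u => Arrow.mk (i.preimage (w'.t₁.inv ≫ w.t₁.hom) ≫ w.wilsonLine (c u).pr)) h1
    fun u _ => ⟨_, _, _, _, _, rfl, rfl, rfl⟩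
  refine h2.arrow_comp hU (smoothOn_const (I := 𝓡 k)
    (Arrow.mk (i.preimage (w.t₂.inv ≫ w'.t₂.hom))) U) fun u _ => ⟨_, _, _, _, _, rfl, rfl, ?_⟩
  congr 1
  apply i.map_injective
  simp [wilsonLine]

end Wilson

/-- The projection of a disjoint union of open sets is a local homeomorphism. -/
theorem isLocalHomeomorph_disjointUnion {M ι : Type*} [TopologicalSpace M] [TopologicalSpace ι]
    [DiscreteTopology ι] {O : ι → Set M} (hO : ∀ j, IsOpen (O j)) :
    IsLocalHomeomorph fun y : {p : M × ι // p.1 ∈ O p.2} => y.1.1 := by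
  have hopen : IsOpen {p : M × ι | p.1 ∈ O p.2} := by
    have : {p : M × ι | p.1 ∈ O p.2} = ⋃ j, O j ×ˢ {j} := by
      ext ⟨x, j⟩
      simp
    rw [this]
    exact isOpen_iUnion fun j => (hO j).prod (isOpen_discrete _)
  have hfst : IsLocalHomeomorph (Prod.fst : M × ι → M) := by
    rintro ⟨x, j⟩
    exact ⟨{ toFun := Prod.fst
             invFun := fun x => (x, j)
             source := univ ×ˢ {j}
             target := univ
             map_source' := fun _ _ => mem_univ _
             map_target' := fun _ _ => ⟨mem_univ _, rfl⟩
             left_inv' := by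
               rintro ⟨a, b⟩ ⟨-, hb⟩
               exact Prod.ext rfl (Eq.symm hb)
             right_inv' := fun _ _ => rfl
             open_source := isOpen_univ.prod (isOpen_discrete _)
             open_target := isOpen_univ
             continuousOn_toFun := continuousOn_fst
             continuousOn_invFun := by fun_prop }, ⟨mem_univ _, rfl⟩, rfl⟩
  exact hfst.comp hopen.isOpenEmbedding_subtypeVal.isLocalHomeomorph

/-! ### Smooth Wilson lines give a transport functor -/

section Reconstruction

variable {d : ℕ} {M : Type*} [TopologicalSpace M] [ChartedSpace (Euc d) M]
  {Gr : Type*} [Groupoid Gr] [TopologicalSpace Gr] [SmoothStructure Gr]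
  [TopologicalSpace (Arrow Gr)] [SmoothStructure (Arrow Gr)]
  {T : Type*} [Category T]
  {i : Gr ⥤ T} {F : PathGroupoid (𝓡 d) M ⥤ T}

/-- A cover of `M` by open sets `O j`, together with smooth families of paths from a base point
`m j` to the points of `O j`, and with trivializations of `F` at the base points. -/
structure RadialCover (i : Gr ⥤ T) (F : PathGroupoid (𝓡 d) M ⥤ T) (ι : Type*) where
  O : ι → Set M
  m : ι → M
  r : ∀ j, ∀ x ∈ O j, SmoothPath (𝓡 d) (m j) x
  ρ : ι → M → ℝ → M
  isOpen : ∀ j, IsOpen (O j)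
  cover : ∀ x, ∃ j, x ∈ O j
  smooth : ∀ j, ContMDiffOn ((𝓡 d).prod 𝓘(ℝ, ℝ)) (𝓡 d) ∞ (fun p : M × ℝ => ρ j p.1 p.2)
    (O j ×ˢ univ)
  ext_r : ∀ j x hx, (r j x hx).ext = ρ j x
  G : ι → Gr
  t : ∀ j, F.obj ⟨m j⟩ ≅ i.obj (G j)

namespace RadialCover

variable {ι : Type*} (C : RadialCover i F ι)

/-- The disjoint union of the sets of the cover. -/
abbrev Total := {p : M × ι // p.1 ∈ C.O p.2}

/-- The projection of the disjoint union of the sets of the cover. -/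
def proj (y : C.Total) : M := y.1.1

/-- The trivialization of `F` at the points of the cover, by transport along the radial paths. -/
noncomputable def τ (y : C.Total) : F.obj ⟨C.proj y⟩ ≅ i.obj (C.G y.1.2) :=
  (asIso (F.map (C.r y.1.2 y.1.1 y.2).pr)).symm ≪≫ C.t y.1.2

/-- The arrow of `Gr` that represents `F` on a morphism, in the trivializations `τ`. -/
noncomputable def arrow [i.IsEquivalence] (y y' : C.Total)
    (a : (⟨C.proj y⟩ : PathGroupoid (𝓡 d) M) ⟶ ⟨C.proj y'⟩) : C.G y.1.2 ⟶ C.G y'.1.2 :=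
  i.preimage ((C.τ y).inv ≫ F.map a ≫ (C.τ y').hom)

variable [TopologicalSpace ι] [DiscreteTopology ι] [LieGroupoid Gr] [i.IsEquivalence]

/-- Smooth families of paths in `M` are represented by smooth families of arrows, if the Wilson
lines are smooth. -/
theorem smoothOn_arrow (w : ∀ x₁ x₂ : M, WilsonChoice i F x₁ x₂)
    (hw : ∀ x₁ x₂, (w x₁ x₂).IsSmooth) {k : ℕ} {U : Set (Euc k)} (hU : IsOpen U)
    (y y' : Euc k → C.Total) (γ : ∀ u, SmoothPath (𝓡 d) (C.proj (y u)) (C.proj (y' u)))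
    (hy : ContinuousOn (fun u => (y u).1.2) U) (hy' : ContinuousOn (fun u => (y' u).1.2) U)
    (hγ : SmoothLineFamilyOn (𝓡 d) (fun u t => (γ u).ext (SmoothPath.step t)) U) :
    SmoothOn (𝓡 k) (fun u => Arrow.mk (C.arrow (y u) (y' u) (γ u).pr)) U := by
  refine smoothOn_of_locally fun u₀ hu₀ => ?_
  set j := (y u₀).1.2
  set j' := (y' u₀).1.2
  -- As `ι` is discrete, the indices of both end points are locally constant; on `V` they are `j`
  -- and `j'`, so a single Wilson line, from `C.m j` to `C.m j'`, is involved.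
  set V : Set (Euc k) := (U ∩ (fun u => (y u).1.2) ⁻¹' {j}) ∩
    (U ∩ (fun u => (y' u).1.2) ⁻¹' {j'}) with hV
  have hVo : IsOpen V := (hy.isOpen_inter_preimage hU (isOpen_discrete _)).inter
    (hy'.isOpen_inter_preimage hU (isOpen_discrete _))
  refine ⟨V, hVo, ⟨⟨hu₀, rfl⟩, hu₀, rfl⟩, ?_⟩
  have hVU : V ⊆ U := fun u hu => hu.1.1
  have memj : ∀ u ∈ V, C.proj (y u) ∈ C.O j := fun u hu => by
    have h1 : (y u).1.2 = j := hu.1.2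
    have := (y u).2
    rwa [h1] at this
  have memj' : ∀ u ∈ V, C.proj (y' u) ∈ C.O j' := fun u hu => by
    have h1 : (y' u).1.2 = j' := hu.2.2
    have := (y' u).2
    rwa [h1] at this
  -- The path whose Wilson line represents `γ u`, slowed down in the form that
  -- `SmoothLineFamilyOn.concat` expects. Outside `V` any path between the two centres will do; the
  -- one through `γ u₀` is available.
  have hP : ∀ u, ∃ P : SmoothPath (𝓡 d) (C.m j) (C.m j'), ∀ hu : u ∈ V,
      P = ((C.r j _ (memj u hu)).slow.trans (γ u).slow).slow.trans
        (C.r j' _ (memj' u hu)).symm.slow := by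
    intro u
    by_cases hu : u ∈ V
    · exact ⟨((C.r j _ (memj u hu)).slow.trans (γ u).slow).slow.trans
        (C.r j' _ (memj' u hu)).symm.slow, fun _ => rfl⟩
    · exact ⟨((C.r j _ (y u₀).2).trans (γ u₀)).trans (C.r j' _ (y' u₀).2).symm,
        fun h => absurd h hu⟩
  choose P hP using hP
  have hγV := hγ.mono hVU
  have radial : ∀ (l : ι) (z : Euc k → M), ContMDiffOn (𝓡 k) (𝓡 d) ∞ z V →
      (∀ u ∈ V, z u ∈ C.O l) → SmoothLineFamilyOn (𝓡 d) (fun u => C.ρ l (z u)) V := by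
    intro l z hz hzm
    have h1 : ContMDiffOn ((𝓡 k).prod 𝓘(ℝ, ℝ)) ((𝓡 d).prod 𝓘(ℝ, ℝ)) ∞
        (fun p : Euc k × ℝ => (z p.1, p.2)) (V ×ˢ univ) :=
      (hz.comp contMDiffOn_fst fun p hp => hp.1).prodMk contMDiffOn_snd
    exact ContMDiffOn.comp (C.smooth l) h1 fun p hp => ⟨hzm _ hp.1, mem_univ _⟩
  -- The end points vary smoothly because they are the values of the family at times `0` and `1`.
  have hz : ContMDiffOn (𝓡 k) (𝓡 d) ∞ (fun u => C.proj (y u)) V :=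
    (hγV.eval 0).congr fun u _ => by
      rw [SmoothPath.step_lo (by norm_num), SmoothPath.ext_zero]
  have hz' : ContMDiffOn (𝓡 k) (𝓡 d) ∞ (fun u => C.proj (y' u)) V :=
    (hγV.eval 1).congr fun u _ => by
      rw [SmoothPath.step_hi (by norm_num), SmoothPath.ext_one]
  have s1 := (radial j _ hz memj).reparam SmoothPath.step_contDiff
  have s2 := (radial j' _ hz' memj').reparam (φ := fun t => 1 - SmoothPath.step t)
    (contDiff_const.sub SmoothPath.step_contDiff)
  classical
  have s3 : SmoothLineFamilyOn (𝓡 d) (fun u t => if hu : u ∈ V then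
      ((C.r j _ (memj u hu)).slow.trans (γ u).slow).ext t else C.m j) V :=
    s1.concat hγV fun u hu => ⟨_, _, _, C.r j _ (memj u hu), γ u,
      by rw [SmoothPath.slow_ext, C.ext_r], SmoothPath.slow_ext _, by simp only [dif_pos hu]⟩
  have s4 : SmoothLineFamilyOn (𝓡 d) (fun u => (P u).ext) V :=
    (s3.reparam SmoothPath.step_contDiff).concat s2 fun u hu => ⟨_, _, _,
      (C.r j _ (memj u hu)).slow.trans (γ u).slow, (C.r j' _ (memj' u hu)).symm,
      by rw [SmoothPath.slow_ext]; simp only [dif_pos hu],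
      by rw [SmoothPath.slow_ext, SmoothPath.symm_ext, C.ext_r], by rw [hP u hu]⟩
  have s5 := (hw (C.m j) (C.m j')).change ⟨C.G j, C.G j', C.t j, C.t j'⟩ k V hVo P
    (SmoothLineFamilyOn.smoothFamilyOn s4)
  refine (s5.mono inter_subset_right).congr fun u hu => ?_
  have hu := hu.2
  -- The radial paths and `C.t` combine to the trivializations `τ`. Variable indices `l`, `l'` allow
  -- the equations with `j`, `j'` to be substituted.
  have aux : ∀ (y y' : C.Total) (l l' : ι) (γ : SmoothPath (𝓡 d) (C.proj y) (C.proj y'))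
      (hl : C.proj y ∈ C.O l) (hl' : C.proj y' ∈ C.O l'), y.1.2 = l → y'.1.2 = l' →
      Arrow.mk (C.arrow y y' γ.pr) = Arrow.mk
        ((⟨C.G l, C.G l', C.t l, C.t l'⟩ : WilsonChoice i F (C.m l) (C.m l')).wilsonLine
          (((C.r l _ hl).slow.trans γ.slow).slow.trans (C.r l' _ hl').symm.slow).pr) := by
    rintro y y' _ _ γ hl hl' rfl rfl
    congr 1
    apply i.map_injective
    simp only [arrow, WilsonChoice.wilsonLine, Functor.map_preimage, SmoothPath.pr_trans,
      SmoothPath.pr_slow, SmoothPath.pr_symm, τ, Functor.map_comp]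
    simp [proj]
  dsimp only
  rw [hP u hu]
  exact aux _ _ _ _ _ _ _ hu.1.2 hu.2.2

/-- The functor that represents `F` on the disjoint union of the sets of the cover. -/
noncomputable def triv [ChartedSpace (Euc d) C.Total] (hπ : ContMDiff (𝓡 d) (𝓡 d) ∞ C.proj) :
    PathGroupoid (𝓡 d) C.Total ⥤ Gr where
  obj y := C.G y.pt.1.2
  map {a b} γ := C.arrow a.pt b.pt ((PathGroupoid.map hπ).map γ)
  map_id a := by
    apply i.map_injective
    rw [CategoryTheory.Functor.map_id]
    simp only [arrow, Functor.map_preimage]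
    erw [CategoryTheory.Functor.map_id]
    simp
  map_comp f g := by
    apply i.map_injective
    rw [CategoryTheory.Functor.map_comp]
    simp only [arrow, Functor.map_preimage, i.map_comp]
    erw [CategoryTheory.Functor.map_comp]
    simp
    rfl

/-- The local trivialization given by a radial cover. -/
noncomputable def localTrivialization [ChartedSpace (Euc d) C.Total]
    (hπ : ContMDiff (𝓡 d) (𝓡 d) ∞ C.proj) : LocalTrivialization i F C.proj hπ where
  triv := C.triv hπ
  t := NatIso.ofComponents (fun y => C.τ y.pt) (by
    intro a b γ
    refine Eq.trans ?_ (congrArg ((C.τ a.pt).hom ≫ ·) (i.map_preimage _)).symm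
    exact (Iso.hom_inv_id_assoc _ _).symm)

/-- `triv` is locally constant on objects. On families of paths, and for the transitions, smoothness
is an instance of `smoothOn_arrow`, and naturality holds because two paths with the same projection
to `M` represent the same morphism there. -/
theorem hasSmoothDescent [ChartedSpace (Euc d) C.Total]
    (hπ : ContMDiff (𝓡 d) (𝓡 d) ∞ C.proj) (w : ∀ x₁ x₂ : M, WilsonChoice i F x₁ x₂)
    (hw : ∀ x₁ x₂, (w x₁ x₂).IsSmooth) : (C.localTrivialization hπ).HasSmoothDescent := by
  have hidx : Continuous fun y : C.Total => y.1.2 := continuous_snd.comp continuous_subtype_val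
  refine ⟨⟨?_, ?_⟩, fun α => C.arrow α.1.1 α.1.2 (eqToHom (congrArg PathGroupoid.mk α.2)),
    ?_, ?_, ?_⟩
  · refine smoothOn_of_locally fun y _ => ?_
    refine ⟨(fun y : C.Total => y.1.2) ⁻¹' {y.1.2}, (isOpen_discrete _).preimage hidx, rfl, ?_⟩
    refine (smoothOn_const (C.G y.1.2) _).congr fun z hz => ?_
    have : z.1.2 = y.1.2 := hz.2
    exact congrArg C.G this
  · intro k U hU c hc
    have hc' : SmoothFamilyOn (fun u => (⟨_, _, (c u).2.2.map hπ⟩ : PathSpace (𝓡 d) M)) U :=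
      hπ.comp_contMDiffOn hc
    -- A smooth family in the disjoint union is in particular continuous, so at each fixed time its
    -- index is continuous in the parameter.
    have ends : ∀ s : unitInterval, ContinuousOn (fun u => ((c u).2.2.toPath s).1.2) U := by
      intro s
      have h1 : ContinuousOn (fun u => (c u).2.2.toPath s) U :=
        ContinuousOn.comp (f := fun u : Euc k => (u, s)) (ContMDiffOn.continuousOn hc)
          (by fun_prop) fun u hu => ⟨hu, mem_univ _⟩
      exact hidx.comp_continuousOn h1
    refine C.smoothOn_arrow w hw hU (fun u => (c u).1) (fun u => (c u).2.1)
      (fun u => (c u).2.2.map hπ) ?_ ?_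
      (hc'.reparam SmoothPath.step_contDiff SmoothPath.step_mem)
    · exact (ends 0).congr fun u _ => (congrArg (fun z : C.Total => z.1.2) (c u).2.2.toPath.source).symm
    · exact (ends 1).congr fun u _ => (congrArg (fun z : C.Total => z.1.2) (c u).2.2.toPath.target).symm
  · intro α β γ₁ γ₂ h
    have key : (γ₁.map hπ).pr ≫ eqToHom (congrArg PathGroupoid.mk β.2) =
        eqToHom (congrArg PathGroupoid.mk α.2) ≫ (γ₂.map hπ).pr :=
      pr_comp_eqToHom α.2 β.2 _ _ (funext fun t => h _)
    have key' := congrArg F.map key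
    rw [F.map_comp, F.map_comp] at key'
    apply i.map_injective
    change i.map (C.arrow _ _ (γ₁.map hπ).pr ≫ _) = i.map (_ ≫ C.arrow _ _ (γ₂.map hπ).pr)
    simp only [arrow, i.map_comp, Functor.map_preimage, Category.assoc, Iso.hom_inv_id_assoc]
    rw [reassoc_of% key']
  · intro k U hU c hc
    -- The transition at `c u` is the arrow of an `eqToHom`, here replaced by the class of a
    -- constant path.
    choose γ hγ₁ hγ₂ using fun u => exists_pr_eq_eqToHom (I := 𝓡 d) (c u).2
    have h1 : ContMDiffOn (𝓡 k) (𝓡 d) ∞ (fun u => C.proj (c u).1.1) U :=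
      hπ.comp_contMDiffOn (contMDiff_fst.comp_contMDiffOn hc)
    have h2 : SmoothLineFamilyOn (𝓡 d) (fun u t => (γ u).ext (SmoothPath.step t)) U := by
      simp only [hγ₁]
      exact h1.comp contMDiffOn_fst fun p hp => hp.1
    refine (C.smoothOn_arrow w hw hU (fun u => (c u).1.1) (fun u => (c u).1.2) γ
      (hidx.comp_continuousOn (continuous_fst.comp_continuousOn hc.continuousOn))
      (hidx.comp_continuousOn (continuous_snd.comp_continuousOn hc.continuousOn)) h2).congr
      fun u _ => ?_
    dsimp only
    rw [hγ₂]
    rfl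
  · intro α
    refine (i.map_preimage _).trans ?_
    rw [eqToHom_map]
    rfl

end RadialCover

/-- A functor with smooth Wilson lines is a transport functor. -/
theorem isTransportFunctor_of_smooth_wilsonLines.{u} {d : ℕ} {M : Type u} [TopologicalSpace M]
    [T2Space M] [SecondCountableTopology M] [ChartedSpace (Euc d) M] [IsManifold (𝓡 d) ∞ M]
    {Gr : Type*} [Groupoid Gr] [TopologicalSpace Gr] [SmoothStructure Gr]
    [TopologicalSpace (Arrow Gr)] [SmoothStructure (Arrow Gr)] [LieGroupoid Gr]
    {T : Type*} [Category T] {i : Gr ⥤ T} [i.IsEquivalence] {F : PathGroupoid (𝓡 d) M ⥤ T}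
    (w : ∀ x₁ x₂ : M, WilsonChoice i F x₁ x₂) (hw : ∀ x₁ x₂, (w x₁ x₂).IsSmooth) :
    IsTransportFunctor i F := by
  choose O r ρ h1 h2 h3 h4 using exists_radial_paths (d := d) (M := M)
  obtain ⟨s, hs, hcov⟩ := TopologicalSpace.countable_cover_nhds
    (f := O) fun x => (h1 x).mem_nhds (h2 x)
  -- The existential hides that `ι` is a subset of `M`, whose subspace topology would compete with
  -- the discrete one. Countability makes the disjoint union second countable.
  obtain ⟨ι, _, _, _, m, hm⟩ : ∃ (ι : Type u) (_ : TopologicalSpace ι) (_ : DiscreteTopology ι)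
      (_ : Countable ι) (m : ι → M), ∀ x, ∃ j, x ∈ O (m j) := by
    refine ⟨s, ⊥, @DiscreteTopology.mk _ ⊥ rfl, hs.to_subtype, Subtype.val, fun x => ?_⟩
    have : x ∈ ⋃ x ∈ s, O x := hcov ▸ mem_univ x
    obtain ⟨y, hy, hxy⟩ := mem_iUnion₂.1 this
    exact ⟨⟨y, hy⟩, hxy⟩
  let C : RadialCover i F ι :=
    { O := fun j => O (m j)
      m := m
      r := fun j => r (m j)
      ρ := fun j => ρ (m j)
      isOpen := fun j => h1 (m j)
      cover := hm
      smooth := fun j => h3 (m j)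
      ext_r := fun j => h4 (m j)
      G := fun j => (w (m j) (m j)).G₁
      t := fun j => (w (m j) (m j)).t₁ }
  have hloc : IsLocalHomeomorph C.proj := isLocalHomeomorph_disjointUnion C.isOpen
  let inst := pullbackChartedSpace (d := d) hloc
  refine ⟨d, C.Total, inferInstance, inst, inferInstance,
    inferInstanceAs (SecondCountableTopology ↥{p : M × ι | p.1 ∈ C.O p.2}),
    isManifold_pullback hloc, C.proj, fun x => ?_, isSubmersion_pullback hloc,
    C.localTrivialization _, C.hasSmoothDescent _ w hw⟩
  obtain ⟨j, hj⟩ := C.cover x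
  exact ⟨⟨(x, j), hj⟩, rfl⟩

end Reconstruction

/-! ### Transport functors have smooth Wilson lines -/

/-- Submersions have smooth local sections through every point. -/
theorem exists_local_section {d e : ℕ} {M : Type*} [TopologicalSpace M] [ChartedSpace (Euc d) M]
    [IsManifold (𝓡 d) ∞ M] {Y : Type*} [TopologicalSpace Y] [ChartedSpace (Euc e) Y]
    [IsManifold (𝓡 e) ∞ Y] {π : Y → M} (hπ : Manifold.IsSubmersion (𝓡 e) (𝓡 d) ∞ π) (y : Y) :
    ∃ (V : Set M) (σ : M → Y), IsOpen V ∧ π y ∈ V ∧ ContMDiffOn (𝓡 d) (𝓡 e) ∞ σ V ∧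
      ∀ z ∈ V, π (σ z) = z := by
  have h := hπ.isSubmersionAt y
  set φ := h.domChart with hφ
  set ψ := h.codChart with hψ
  have hy : y ∈ φ.source := h.mem_domChart_source
  have hw : ∀ v ∈ φ.target, ψ (π (φ.symm v)) = (h.equiv v).1 := fun v hv => by
    have hv' : v ∈ (φ.extend (𝓡 e)).target := by simpa using hv
    simpa using h.writtenInCharts hv'
  -- In adapted charts the submersion is the projection to the first factor; the section keeps the
  -- complementary coordinate equal to that of `y`.
  set b := (h.equiv (φ y)).2 with hb
  set j : Euc d → Euc e := fun v => h.equiv.symm (v, b) with hj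
  have hjs : ContDiff ℝ ∞ j := h.equiv.symm.contDiff.comp (contDiff_id.prodMk contDiff_const)
  have hψs : ContMDiffOn (𝓡 d) (𝓡 d) ∞ ψ ψ.source :=
    contMDiffOn_of_mem_maximalAtlas h.codChart_mem_maximalAtlas
  have hφs : ContMDiffOn (𝓡 e) (𝓡 e) ∞ φ.symm φ.target :=
    contMDiffOn_symm_of_mem_maximalAtlas h.domChart_mem_maximalAtlas
  have hj1 : ContMDiffOn (𝓡 d) (𝓡 e) ∞ (fun z => j (ψ z)) ψ.source :=
    hjs.contMDiff.comp_contMDiffOn hψs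
  refine ⟨ψ.source ∩ (fun z => j (ψ z)) ⁻¹' φ.target, fun z => φ.symm (j (ψ z)),
    hj1.continuousOn.isOpen_inter_preimage ψ.open_source φ.open_target,
    ⟨h.mem_codChart_source, ?_⟩,
    hφs.comp (hj1.mono inter_subset_left) fun z hz => hz.2, ?_⟩
  · have h1 : ψ (π y) = (h.equiv (φ y)).1 := by
      rw [← hw _ (φ.map_source hy), φ.left_inv hy]
    change h.equiv.symm (ψ (π y), (h.equiv (φ y)).2) ∈ φ.target
    rw [h1, Prod.mk.eta, ContinuousLinearEquiv.symm_apply_apply]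
    exact φ.map_source hy
  · rintro z ⟨hz, hz'⟩
    have h2 : φ.symm (j (ψ z)) ∈ φ.source := φ.map_target hz'
    refine ψ.injOn (h.source_subset_preimage_source h2) hz ?_
    rw [hw _ hz']
    simp [hj]

section Paths

variable {E : Type*} [NormedAddCommGroup E] [NormedSpace ℝ E]
  {H : Type*} [TopologicalSpace H] {I : ModelWithCorners ℝ E H}
  {M : Type*} [TopologicalSpace M] [ChartedSpace H M]
  {E' : Type*} [NormedAddCommGroup E'] [NormedSpace ℝ E']
  {H' : Type*} [TopologicalSpace H'] {I' : ModelWithCorners ℝ E' H'}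
  {Y : Type*} [TopologicalSpace Y] [ChartedSpace H' Y]

/-- A path may be composed with a map that is only smooth on a set containing it. -/
theorem SmoothPath.exists_mapOn {x y : M} (γ : SmoothPath I x y) {V : Set M} {σ : M → Y}
    (hσ : ContMDiffOn I I' ∞ σ V) (h : ∀ t, γ.ext t ∈ V) :
    ∃ γ' : SmoothPath I' (σ x) (σ y), γ'.ext = fun t => σ (γ.ext t) := by
  obtain ⟨ε, h0, -, h1, h2⟩ := γ.ext_sitting
  exact ⟨SmoothPath.ofLine (fun t => σ (γ.ext t)) (hσ.comp_contMDiff γ.ext_smooth h)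
    ⟨ε, h0, fun t ht => congrArg σ (h1 t ht), fun t ht => congrArg σ (h2 t ht)⟩,
    SmoothPath.ofLine_ext _ _⟩

/-- A form of `segment_comp` for paths that only have the extensions of segments: the projection of
a lifted segment ends at a point `π (σ _)`, which equals the point of `γ` only propositionally. -/
theorem SmoothPath.pr_comp_of_ext {x y x' y' y'' z' : M} (γ : SmoothPath I x y) {a b c : ℝ}
    (p : SmoothPath I x' y') (r : SmoothPath I y'' z') (s : SmoothPath I x' z')
    (hp : p.ext = (γ.segment a b).ext) (hr : r.ext = (γ.segment b c).ext)
    (hs : s.ext = (γ.segment a c).ext) (h : y' = y'') :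
    (p.pr ≫ eqToHom (congrArg PathGroupoid.mk h)) ≫ r.pr = s.pr := by
  subst h
  obtain rfl : γ.ext a = x' := by
    rw [← p.ext_zero, hp, ext_zero]
  obtain rfl : γ.ext b = y' := by
    rw [← p.ext_one, hp, ext_one]
  obtain rfl : γ.ext c = z' := by
    rw [← r.ext_one, hr, ext_one]
  cases ext_injective hp
  cases ext_injective hr
  cases ext_injective hs
  simp [segment_comp]

theorem SmoothPath.map_ext {x y : M} (γ : SmoothPath I x y) {f : M → Y} (hf : ContMDiff I I' ∞ f) :
    (γ.map hf).ext = fun t => f (γ.ext t) := rfl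

end Paths

/-! ### Arrows of `Gr` representing `F` in a local trivialization -/

section Descent

variable {E : Type*} [NormedAddCommGroup E] [NormedSpace ℝ E]
  {H : Type*} [TopologicalSpace H] {I : ModelWithCorners ℝ E H}
  {M : Type*} [TopologicalSpace M] [ChartedSpace H M]
  {E' : Type*} [NormedAddCommGroup E'] [NormedSpace ℝ E']
  {H' : Type*} [TopologicalSpace H'] {I' : ModelWithCorners ℝ E' H'}
  {Y : Type*} [TopologicalSpace Y] [ChartedSpace H' Y]
  {Gr : Type*} [Groupoid Gr] {T : Type*} [Category T] {i : Gr ⥤ T} {F : PathGroupoid I M ⥤ T}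
  {π : Y → M} {hπ : ContMDiff I' I ∞ π} (L : LocalTrivialization i F π hπ)

namespace LocalTrivialization

/-- The component of a local trivialization at a point. -/
noncomputable def iso (y : Y) : F.obj ⟨π y⟩ ≅ i.obj (L.triv.obj ⟨y⟩) := L.t.app ⟨y⟩

theorem iso_naturality {y y' : Y} (γ : SmoothPath I' y y') :
    F.map (γ.map hπ).pr ≫ (L.iso y').hom = (L.iso y).hom ≫ i.map (L.triv.map γ.pr) :=
  L.t.hom.naturality γ.pr

theorem transition_eq (α : FibreProduct π) : L.transition α =
    (L.iso α.1.1).inv ≫ eqToHom (congrArg (fun m => F.obj (PathGroupoid.mk m)) α.2) ≫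
      (L.iso α.1.2).hom := rfl

variable [i.IsEquivalence]

/-- The arrow of `Gr` that represents `F` on a morphism, in a local trivialization. -/
noncomputable def arrow (y y' : Y)
    (a : (⟨π y⟩ : PathGroupoid I M) ⟶ ⟨π y'⟩) : L.triv.obj ⟨y⟩ ⟶ L.triv.obj ⟨y'⟩ :=
  i.preimage ((L.iso y).inv ≫ F.map a ≫ (L.iso y').hom)

/-- Naturality of the trivialization: continuing along a path that lifts to `Y` is composition with
`triv`. -/
theorem arrow_comp_triv (y y' y'' : Y) (a : (⟨π y⟩ : PathGroupoid I M) ⟶ ⟨π y'⟩)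
    (γ : SmoothPath I' y' y'') :
    L.arrow y y' a ≫ L.triv.map γ.pr = L.arrow y y'' (a ≫ (γ.map hπ).pr) := by
  apply i.map_injective
  simp only [arrow, i.map_comp, Functor.map_preimage, F.map_comp, Category.assoc]
  rw [iso_naturality]

/-- The trivialization at `y'` cancels against its inverse in the transition, so composing with the
transition only replaces the lift of the end point. -/
theorem arrow_comp_transition (y y' y'' : Y) (a : (⟨π y⟩ : PathGroupoid I M) ⟶ ⟨π y'⟩)
    (h : π y' = π y'') (g : L.triv.obj ⟨y'⟩ ⟶ L.triv.obj ⟨y''⟩)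
    (hg : i.map g = L.transition ⟨(y', y''), h⟩) :
    L.arrow y y' a ≫ g = L.arrow y y'' (a ≫ eqToHom (congrArg PathGroupoid.mk h)) := by
  apply i.map_injective
  simp only [arrow, i.map_comp, Functor.map_preimage, F.map_comp, Category.assoc, hg,
    transition_eq, eqToHom_map, Iso.hom_inv_id_assoc]

variable {L} [TopologicalSpace Gr] [SmoothStructure Gr] [TopologicalSpace (Arrow Gr)]
  [SmoothStructure (Arrow Gr)] [LieGroupoid Gr] {k : ℕ} {U : Set (Euc k)}

/-- Passing to another lift of the end points preserves smoothness of families of arrows. -/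
theorem HasSmoothDescent.smoothOn_change (hL : L.HasSmoothDescent) (hU : IsOpen U) {y₁ : Y}
    {z z' : Euc k → Y} (hz : ContMDiffOn (𝓡 k) I' ∞ z U) (hz' : ContMDiffOn (𝓡 k) I' ∞ z' U)
    {q q' : Euc k → Arrow Gr} (hq : SmoothOn (𝓡 k) q U)
    (hqq' : ∀ u ∈ U, ∃ (h : π (z u) = π (z' u)) (a : (⟨π y₁⟩ : PathGroupoid I M) ⟶ ⟨π (z u)⟩),
      q u = Arrow.mk (L.arrow y₁ (z u) a) ∧
      q' u = Arrow.mk (L.arrow y₁ (z' u) (a ≫ eqToHom (congrArg PathGroupoid.mk h)))) :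
    SmoothOn (𝓡 k) q' U := by
  obtain ⟨-, g', -, hg, hi⟩ := hL
  -- The descent condition takes families defined on all of `ℝᵏ`; outside `U` a diagonal point
  -- serves as default.
  have h1 : ∀ u, ∃ α : FibreProduct π, u ∈ U → α.1 = (z u, z' u) := by
    intro u
    by_cases hu : u ∈ U
    · exact ⟨⟨(z u, z' u), (hqq' u hu).1⟩, fun _ => rfl⟩
    · exact ⟨⟨(y₁, y₁), rfl⟩, fun h => absurd h hu⟩
  choose α hα using h1
  have h2 := hg k U hU α ((hz.prodMk hz').congr hα)
  refine hq.arrow_comp hU h2 fun u hu => ?_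
  obtain ⟨h, a, e1, e2⟩ := hqq' u hu
  obtain h3 : α u = ⟨(z u, z' u), h⟩ := Subtype.ext (hα u hu)
  refine ⟨_, _, _, L.arrow y₁ (z u) a, g' ⟨(z u, z' u), h⟩, e1, by rw [h3], ?_⟩
  rw [e2, L.arrow_comp_transition _ _ _ a h _ (hi _)]

/-- Continuing along paths which lift to a smooth family of paths preserves smoothness of families
of arrows. -/
theorem HasSmoothDescent.smoothOn_extend (hL : L.HasSmoothDescent) (hU : IsOpen U) {y₁ : Y}
    {z z' : Euc k → Y} {q q' : Euc k → Arrow Gr} (hq : SmoothOn (𝓡 k) q U)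
    {f : Euc k → ℝ → Y} (hf : SmoothLineFamilyOn I' f U)
    (hqq' : ∀ u ∈ U, ∃ (γ : SmoothPath I' (z u) (z' u))
      (a : (⟨π y₁⟩ : PathGroupoid I M) ⟶ ⟨π (z u)⟩), γ.ext = f u ∧
      q u = Arrow.mk (L.arrow y₁ (z u) a) ∧
      q' u = Arrow.mk (L.arrow y₁ (z' u) (a ≫ (γ.map hπ).pr))) :
    SmoothOn (𝓡 k) q' U := by
  have h1 : ∀ u, ∃ p : PathSpace I' Y, ∀ hu : u ∈ U, p = ⟨_, _, (hqq' u hu).choose⟩ := by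
    intro u
    by_cases hu : u ∈ U
    · exact ⟨⟨_, _, (hqq' u hu).choose⟩, fun _ => rfl⟩
    · exact ⟨⟨y₁, y₁, SmoothPath.refl y₁⟩, fun h => absurd h hu⟩
  choose p hp using h1
  -- The lifted paths are chosen separately for each `u`, but their extensions are prescribed by
  -- `f`, so the choice does not affect smoothness.
  have h2 : SmoothLineFamilyOn I' (fun u => (p u).2.2.ext) U := by
    refine ContMDiffOn.congr hf ?_
    rintro ⟨u, t⟩ ⟨hu, -⟩
    dsimp only
    rw [hp u hu]
    exact congrFun (hqq' u hu).choose_spec.choose_spec.1 t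
  have h3 := hL.1.2 k U hU p h2.smoothFamilyOn
  refine hq.arrow_comp hU h3 fun u hu => ?_
  obtain ⟨a, -, e1, e2⟩ := (hqq' u hu).choose_spec
  refine ⟨_, _, _, L.arrow y₁ (z u) a, L.triv.map (hqq' u hu).choose.pr, e1, by rw [hp u hu],
    e2.trans (congrArg Arrow.mk (L.arrow_comp_triv _ _ _ a _).symm)⟩

end LocalTrivialization

end Descent

theorem SmoothPath.exists_cast {E : Type*} [NormedAddCommGroup E] [NormedSpace ℝ E]
    {H : Type*} [TopologicalSpace H] {I : ModelWithCorners ℝ E H}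
    {M : Type*} [TopologicalSpace M] [ChartedSpace H M] {x y x' y' : M} (γ : SmoothPath I x y)
    (hx : x = x') (hy : y = y') : ∃ γ' : SmoothPath I x' y', γ'.ext = γ.ext := by
  subst hx hy
  exact ⟨γ, rfl⟩

/-! ### Transport along a subdivided family of paths -/

section Transport

variable {d e : ℕ} {M : Type*} [TopologicalSpace M] [ChartedSpace (Euc d) M]
  [IsManifold (𝓡 d) ∞ M]
  {Y : Type*} [TopologicalSpace Y] [ChartedSpace (Euc e) Y] [IsManifold (𝓡 e) ∞ Y]
  {Gr : Type*} [Groupoid Gr] [TopologicalSpace Gr] [SmoothStructure Gr]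
  [TopologicalSpace (Arrow Gr)] [SmoothStructure (Arrow Gr)] [LieGroupoid Gr]
  {T : Type*} [Category T] {i : Gr ⥤ T} [i.IsEquivalence] {F : PathGroupoid (𝓡 d) M ⥤ T}
  {π : Y → M}

/-- In a local trivialization with smooth descent data, smooth families of paths between two fixed
points are represented by smooth families of arrows. -/
theorem LocalTrivialization.HasSmoothDescent.smoothOn_arrow (hs : Function.Surjective π)
    (hπ : Manifold.IsSubmersion (𝓡 e) (𝓡 d) ∞ π) {L : LocalTrivialization i F π hπ.contMDiff}
    (hL : L.HasSmoothDescent) {k : ℕ} {U : Set (Euc k)} (hU : IsOpen U) (y₁ y₂ : Y)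
    (c : Euc k → SmoothPath (𝓡 d) (π y₁) (π y₂))
    (hc : SmoothFamilyOn (fun u => ⟨π y₁, π y₂, c u⟩) U) :
    SmoothOn (𝓡 k) (fun u => Arrow.mk (L.arrow y₁ y₂ (c u).pr)) U := by
  refine smoothOn_of_locally fun u₀ hu₀ => ?_
  have hsec : ∀ x : M, ∃ (V : Set M) (σ : M → Y), IsOpen V ∧ x ∈ V ∧
      ContMDiffOn (𝓡 d) (𝓡 e) ∞ σ V ∧ ∀ z ∈ V, π (σ z) = z := fun x => by
    obtain ⟨y, rfl⟩ := hs x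
    exact exists_local_section hπ y
  choose V σ hV hxV hσ hσπ using hsec
  -- A subdivision of `[0,1]` such that `c u₀` maps each piece into the domain of one local section.
  obtain ⟨t, t0, tmono, ⟨N, hN⟩, ht⟩ := exists_monotone_Icc_subset_open_cover_unitInterval
    (c := fun s => (c u₀).toPath ⁻¹' V ((c u₀).toPath s))
    (fun s => (hV _).preimage (c u₀).toPath.continuous)
    (fun s _ => mem_iUnion.2 ⟨s, hxV _⟩)
  -- Induction along the subdivision: for `u` in a neighbourhood `W` of `u₀`, there are a smooth
  -- lift `z u` of the point reached at time `t n` and a smooth family `q` of arrows representing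
  -- transport up to that time. `W` may shrink at every step, which is harmless since `t N = 1` for
  -- some `N`.
  have key : ∀ n, ∃ (W : Set (Euc k)) (z : Euc k → Y) (q : Euc k → Arrow Gr), IsOpen W ∧ u₀ ∈ W ∧
      W ⊆ U ∧ ContMDiffOn (𝓡 k) (𝓡 e) ∞ z W ∧ SmoothOn (𝓡 k) q W ∧
      ∀ u ∈ W, ∃ γ : SmoothPath (𝓡 d) (π y₁) (π (z u)),
        γ.ext = ((c u).segment 0 (t n)).ext ∧ q u = Arrow.mk (L.arrow y₁ (z u) γ.pr) := by
    intro n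
    induction n with
    | zero =>
      refine ⟨U, fun _ => y₁, fun _ => Arrow.mk (L.arrow y₁ y₁ (SmoothPath.refl _).pr), hU, hu₀,
        subset_rfl, contMDiffOn_const, smoothOn_const _ _,
        fun u _ => ⟨SmoothPath.refl _, ?_, rfl⟩⟩
      rw [t0, SmoothPath.segment_ext, SmoothPath.refl_ext]
      simp [SmoothPath.ext_zero]
    | succ n ih =>
      obtain ⟨W, z, q, hW, huW, hWU, hz, hq, hγ⟩ := ih
      obtain ⟨s, hs⟩ := ht n
      generalize (c u₀).toPath s = x at hs
      have hopen : IsOpen ((U ×ˢ univ) ∩ (fun p : Euc k × unitInterval => (c p.1).toPath p.2) ⁻¹'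
          V x) :=
        (ContMDiffOn.continuousOn hc).isOpen_inter_preimage (hU.prod isOpen_univ) (hV x)
      -- By compactness of the time interval, the whole piece of `c u` stays in `V x` for all `u`
      -- near `u₀`, so one section lifts all these pieces.
      obtain ⟨W', A, hW', -, huW', hA, hWA⟩ := generalized_tube_lemma (s := {u₀})
        isCompact_singleton (isCompact_Icc (a := t n) (b := t (n + 1))) hopen (by
          rintro ⟨u, r⟩ ⟨hu, hr⟩
          obtain rfl : u = u₀ := hu
          exact ⟨⟨hu₀, mem_univ _⟩, hs hr⟩)
      have hab : (t n : ℝ) ≤ t (n + 1) := tmono n.le_succ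
      have inab : ∀ r, (t n : ℝ) + SmoothPath.step r * (t (n + 1) - t n) ∈
          Icc (t n : ℝ) (t (n + 1)) := fun r => by
        have h1 := SmoothPath.step_mem r
        exact ⟨by nlinarith [h1.1], by nlinarith [h1.2]⟩
      have in01 : ∀ r, (t n : ℝ) + SmoothPath.step r * (t (n + 1) - t n) ∈ Icc (0 : ℝ) 1 :=
        fun r => ⟨(t n).2.1.trans (inab r).1, (inab r).2.trans (t (n + 1)).2.2⟩
      have hstep := SmoothPath.step_contDiff
      have hf : SmoothLineFamilyOn (𝓡 d) (fun u => ((c u).segment (t n) (t (n + 1))).ext) U := by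
        simp only [SmoothPath.segment_ext]
        exact hc.reparam
          (φ := fun r => (t n : ℝ) + SmoothPath.step r * (t (n + 1) - t n)) (by fun_prop) in01
      have hO : IsOpen (W ∩ W') := hW.inter hW'
      have hmem : ∀ u ∈ W ∩ W', ∀ r, ((c u).segment (t n) (t (n + 1))).ext r ∈ V x := by
        intro u hu r
        have h1 := hWA (mk_mem_prod hu.2 (hA (a := ⟨_, in01 r⟩) (inab r)))
        rw [SmoothPath.segment_ext]
        have h2 := (c u).ext_coe ⟨_, in01 r⟩
        dsimp only at h2 ⊢
        rw [h2]
        exact h1.2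
      have hσf : SmoothLineFamilyOn (𝓡 e)
          (fun u r => σ x (((c u).segment (t n) (t (n + 1))).ext r)) (W ∩ W') :=
        (hσ x).comp (hf.mono (inter_subset_left.trans hWU)) fun p hp => hmem p.1 hp.1 p.2
      have hz' : ContMDiffOn (𝓡 k) (𝓡 e) ∞ (fun u => σ x ((c u).ext (t n))) (W ∩ W') :=
        (hσf.eval 0).congr fun u _ => by rw [SmoothPath.ext_zero]
      have hz'' : ContMDiffOn (𝓡 k) (𝓡 e) ∞ (fun u => σ x ((c u).ext (t (n + 1)))) (W ∩ W') :=
        (hσf.eval 1).congr fun u _ => by rw [SmoothPath.ext_one]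
      -- `q₁` represents transport up to `t n` with the lift moved from `z u` to the section `σ x`;
      -- `q₂` continues it along the lifted piece. Outside the neighbourhood both have an arbitrary
      -- value.
      have hall : ∀ u, ∃ q₁ q₂ : Arrow Gr, u ∈ W ∩ W' →
          ∃ (γ₀ : SmoothPath (𝓡 d) (π y₁) (π (z u))) (h : π (z u) = π (σ x ((c u).ext (t n))))
            (γ₁ : SmoothPath (𝓡 e) (σ x ((c u).ext (t n))) (σ x ((c u).ext (t (n + 1)))))
            (γ₂ : SmoothPath (𝓡 d) (π y₁) (π (σ x ((c u).ext (t (n + 1)))))),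
            γ₁.ext = (fun r => σ x (((c u).segment (t n) (t (n + 1))).ext r)) ∧
            γ₂.ext = ((c u).segment 0 (t (n + 1))).ext ∧
            (γ₀.pr ≫ eqToHom (congrArg PathGroupoid.mk h)) ≫ (γ₁.map hπ.contMDiff).pr = γ₂.pr ∧
            q u = Arrow.mk (L.arrow y₁ (z u) γ₀.pr) ∧
            q₁ = Arrow.mk (L.arrow y₁ _ (γ₀.pr ≫ eqToHom (congrArg PathGroupoid.mk h))) ∧
            q₂ = Arrow.mk (L.arrow y₁ _ γ₂.pr) := by
        intro u
        by_cases hu : u ∈ W ∩ W'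
        · obtain ⟨γ₀, e0, e1⟩ := hγ u hu.1
          have ha : π (σ x ((c u).ext (t n))) = (c u).ext (t n) := hσπ x _ (by
            have := hmem u hu 0
            rwa [SmoothPath.ext_zero] at this)
          have hb : π (σ x ((c u).ext (t (n + 1)))) = (c u).ext (t (n + 1)) := hσπ x _ (by
            have := hmem u hu 1
            rwa [SmoothPath.ext_one] at this)
          have h : π (z u) = π (σ x ((c u).ext (t n))) := by
            rw [ha, ← γ₀.ext_one, e0, SmoothPath.ext_one]
          obtain ⟨γ₁, e2⟩ := ((c u).segment (t n) (t (n + 1))).exists_mapOn (hσ x) (hmem u hu)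
          obtain ⟨γ₂, e3⟩ := ((c u).segment 0 (t (n + 1))).exists_cast (c u).ext_zero hb.symm
          refine ⟨_, _, fun _ => ⟨γ₀, h, γ₁, γ₂, e2, e3, ?_, e1, rfl, rfl⟩⟩
          refine (c u).pr_comp_of_ext γ₀ _ γ₂ e0 ?_ e3 h
          rw [SmoothPath.map_ext, e2]
          exact funext fun r => hσπ x _ (hmem u hu r)
        · exact ⟨q u, q u, fun h => absurd h hu⟩
      choose q₁ q₂ hall using hall
      have hq₁ : SmoothOn (𝓡 k) q₁ (W ∩ W') :=
        hL.smoothOn_change hO (hz.mono inter_subset_left) hz' (hq.mono inter_subset_left)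
          fun u hu => by
            obtain ⟨γ₀, h, γ₁, γ₂, e1, e2, e3, e4, e5, e6⟩ := hall u hu
            exact ⟨h, _, e4, e5⟩
      have hq₂ : SmoothOn (𝓡 k) q₂ (W ∩ W') :=
        hL.smoothOn_extend hO (y₁ := y₁) hq₁ hσf fun u hu => by
          obtain ⟨γ₀, h, γ₁, γ₂, e1, e2, e3, e4, e5, e6⟩ := hall u hu
          exact ⟨γ₁, _, e1, e5, by rw [e3]; exact e6⟩
      refine ⟨W ∩ W', _, q₂, hO, ⟨huW, huW' rfl⟩, inter_subset_left.trans hWU, hz'', hq₂,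
        fun u hu => ?_⟩
      obtain ⟨γ₀, h, γ₁, γ₂, e1, e2, e3, e4, e5, e6⟩ := hall u hu
      exact ⟨γ₂, e2, e6⟩
  obtain ⟨W, z, q, hW, huW, hWU, hz, hq, hγ⟩ := key N
  refine ⟨W, hW, huW, SmoothOn.mono ?_ inter_subset_right⟩
  -- At time `1` the lift `z u` lies over `π y₂`; one last transition moves it to the prescribed
  -- `y₂`.
  refine hL.smoothOn_change hW (y₁ := y₁) hz (contMDiffOn_const (c := y₂)) hq fun u hu => ?_
  obtain ⟨γ, e0, e1⟩ := hγ u hu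
  have hN1 : ((t N : unitInterval) : ℝ) = 1 := by rw [hN N le_rfl]; rfl
  -- The segment from `0` to `1` is the slowed path, which has the thin class of `c u`.
  have e2 : γ.ext = (c u).slow.ext := by
    rw [e0, SmoothPath.segment_ext, SmoothPath.slow_ext, hN1]
    simp
  have h : π (z u) = π y₂ := by
    rw [← γ.ext_one, e2, SmoothPath.ext_one]
  refine ⟨h, γ.pr, e1, ?_⟩
  have e3 := pr_comp_eqToHom rfl h γ (c u).slow e2
  rw [eqToHom_refl, Category.id_comp, SmoothPath.pr_slow] at e3
  rw [e3]

end Transport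

/-- The Wilson lines of a transport functor are smooth. -/
theorem IsTransportFunctor.smooth_wilsonLine {d : ℕ} {M : Type*} [TopologicalSpace M]
    [ChartedSpace (Euc d) M] [IsManifold (𝓡 d) ∞ M]
    {Gr : Type*} [Groupoid Gr] [TopologicalSpace Gr] [SmoothStructure Gr]
    [TopologicalSpace (Arrow Gr)] [SmoothStructure (Arrow Gr)] [LieGroupoid Gr]
    {T : Type*} [Category T] {i : Gr ⥤ T} [i.IsEquivalence] {F : PathGroupoid (𝓡 d) M ⥤ T}
    (hF : IsTransportFunctor i F) {x₁ x₂ : M} (w : WilsonChoice i F x₁ x₂) : w.IsSmooth := by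
  obtain ⟨e, Y, _, _, -, -, _, π, hs, hπ, L, hL⟩ := hF
  obtain ⟨y₁, rfl⟩ := hs x₁
  obtain ⟨y₂, rfl⟩ := hs x₂
  -- With the trivialization itself as the choice, the Wilson line is `L.arrow y₁ y₂` by definition.
  refine WilsonChoice.IsSmooth.change (w := ⟨_, _, L.iso y₁, L.iso y₂⟩) ?_ w
  exact fun k U hU c hc => hL.smoothOn_arrow hs hπ hU y₁ y₂ c hc

end ParallelTransport

theorem mainTheorem4 {d : ℕ} {M : Type*} [TopologicalSpace M] [T2Space M]
    [SecondCountableTopology M] [ChartedSpace (ParallelTransport.Euc d) M] [IsManifold (𝓡 d) ∞ M]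
    {Gr : Type*} [Groupoid Gr] [TopologicalSpace Gr] [ParallelTransport.SmoothStructure Gr]
    [TopologicalSpace (Arrow Gr)] [ParallelTransport.SmoothStructure (Arrow Gr)]
    [ParallelTransport.LieGroupoid Gr]
    {T : Type*} [Category T] (i : Gr ⥤ T) [i.IsEquivalence]
    (F : ParallelTransport.PathGroupoid (𝓡 d) M ⥤ T)
    (w : ∀ x₁ x₂ : M, ParallelTransport.WilsonChoice i F x₁ x₂) :
    ParallelTransport.IsTransportFunctor i F ↔ ∀ x₁ x₂ : M, (w x₁ x₂).IsSmooth :=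
  ⟨fun h x₁ x₂ => h.smooth_wilsonLine (w x₁ x₂),
    ParallelTransport.isTransportFunctor_of_smooth_wilsonLines w⟩
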